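/- Let $k>0$, $r\ge 0$, $x_0\in\mathbf{R}^3$, let $B_{x_0,r}=\{x\in\mathbf{R}^3:|x-x_0|\le r\}$, let $\chi_{B_{x_0,r}}$ be its characteristic function, and put $d=|x-x_0|$. Define $$ u_k(x)=\begin{cases} \dfrac{(i-kr)e^{ik(d-r)}-(i+kr)e^{ik(d+r)}}{2dk^3}, & x\in\mathbf{R}^3\setminus B_{x_0,r},\ x\neq x_0,\\[2mm] \dfrac{(i+kr)\left(e^{ik(r-d)}-e^{ik(r+d)}\right)-2dk}{2dk^3}, & x\in B_{x_0,r}\setminus\{x_0\},\\[2mm] \dfrac{e^{ikr}(1-ikr)-1}{k^2}, & x=x_0. \end{cases} $$ Call a locally integrable function $u:\mathbf{R}^3\to\mathbf{C}$ a radiating solution of $(\Delta+k^2)u=f$ if the equation holds in $\mathbf{R}^3$ in the sense of distributions, $u$ is differentiable outside some ball, and the Sommerfeld condition $$\lim_{|x|\to\infty}|x|\,(\partial_{|x|}-ik)u=0\quad\text{uniformly for } x/|x|\in S^2$$ holds. Then $u_k$ is continuous on $\mathbf{R}^3$ (in particular, its value at $x_0$ is the limiting value), it is a radiating solution of $$-(\Delta+k^2)u=\chi_{B_{x_0,r}},$$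 and every radiating solution of this equation equals $u_k$ almost everywhere. Correspondingly, $-u_k$ is a radiating solution of $(\Delta+k^2)u=\chi_{B_{x_0,r}}$, and every radiating solution of that equation equals $-u_k$ almost everywhere. -/

import Mathlib

open MeasureTheory Filter Topology

namespace Helmholtz

/-- Three-dimensional Euclidean space. -/
abbrev E3 : Type := EuclideanSpace ℝ (Fin 3)

/-- The characteristic function of the closed ball of radius `r` centred at `x₀`. -/
noncomputable def chi (x₀ : E3) (r : ℝ) : E3 → ℂ :=
  (Metric.closedBall x₀ r).indicator (fun _ => (1 : ℂ))

/-- `(Δ + k²) u = f` on the whole space in the sense of distributions. -/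
def IsDistribSolution (k : ℝ) (f u : E3 → ℂ) : Prop :=
  LocallyIntegrable u volume ∧
    ∀ φ : E3 → ℂ, ContDiff ℝ (⊤ : ℕ∞) φ → HasCompactSupport φ →
      ∫ x, u x * (Laplacian.laplacian φ x + (k : ℂ) ^ 2 * φ x) = ∫ x, f x * φ x

/-- The Sommerfeld radiation condition `|x| (∂_{|x|} - i k) u → 0` as `|x| → ∞`, uniformly in the
direction `x / |x|`: the limit is taken along the filter of complements of bounded sets. The radial
derivative has to exist far away from the origin. -/
def SommerfeldCondition (k : ℝ) (u : E3 → ℂ) : Prop :=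
  (∀ᶠ x in Bornology.cobounded E3, DifferentiableAt ℝ u x) ∧
    Tendsto
      (fun x : E3 => (‖x‖ : ℂ) * (fderiv ℝ u x (‖x‖⁻¹ • x) - Complex.I * (k : ℂ) * u x))
      (Bornology.cobounded E3) (𝓝 0)

/-- Radiating solutions of the inhomogeneous Helmholtz equation `(Δ + k²) u = f`. -/
def IsRadiatingSolution (k : ℝ) (f u : E3 → ℂ) : Prop :=
  IsDistribSolution k f u ∧ SommerfeldCondition k u

open Classical in
/-- The closed form, with `d = |x - x₀|`; the value at `x₀` is the limit `d → 0` of the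
expression for the interior of the ball. -/
noncomputable def ballSolution (k r : ℝ) (x₀ x : E3) : ℂ :=
  let i : ℂ := Complex.I
  let d : ℝ := ‖x - x₀‖
  if x = x₀ then
    (Complex.exp (i * k * r) * (1 - i * k * r) - 1) / (k : ℂ) ^ 2
  else if x ∈ Metric.closedBall x₀ r then
    ((i + k * r) * (Complex.exp (i * k * (r - d)) - Complex.exp (i * k * (r + d))) - 2 * d * k)
      / (2 * d * (k : ℂ) ^ 3)
  else
    ((i - k * r) * Complex.exp (i * k * (d - r)) - (i + k * r) * Complex.exp (i * k * (d + r)))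
      / (2 * d * (k : ℂ) ^ 3)

end Helmholtz

namespace Helmholtz

/-! Existence. With d = |x - x₀|, a radial function p(d)/d turns the equation into p'' + k²p = -s
for s < r and p'' + k²p = 0 for s > r. The inner solution with p(0) = 0 (`innerProfile`) and the
outgoing outer one (`outerProfile`) agree at s = r together with their first derivatives, so no
surface term appears. To see this weakly, the pairing with a test function φ is written in polar
coordinates about x₀. It becomes a one-dimensional integral of p against s·M(s), where M is the
spherical mean. Darboux's equation `hasDerivAt_sphereMeanDeriv` carries Δ over to (s·M)'', and
Lagrange's identity `integral_profile_mul_sphereMean` reduces everything to boundary terms that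
cancel or vanish.

Uniqueness. The difference of two radiating solutions solves the homogeneous equation weakly, hence
equals a classical solution v almost everywhere (`exists_smooth_of_isDistribSolution`). For such v
the spherical means are explicit: s·M(s) = ω sin(ks) v(y)/k, with ω the area of the unit sphere
(`sphereMean_of_helmholtz`). If v(y) ≠ 0, the L² mass of v on balls about y therefore grows at least
linearly in the radius. But the Sommerfeld condition, together with the vanishing imaginary flux
through spheres, makes the L² mass on large spheres tend to zero (`sphere_l2_le`), so the growth is
sublinear: a contradiction.

Both halves rest on the divergence theorem on balls, obtained by integrating by parts against radial
cutoffs and comparing in polar coordinates. -/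

/-- The surface measure on the unit sphere. -/
noncomputable abbrev sigma : Measure (Metric.sphere (0 : E3) 1) := (volume : Measure E3).toSphere

theorem integrable_sphere {F : Type*} [NormedAddCommGroup F]
    {f : Metric.sphere (0 : E3) 1 → F} (hf : Continuous f) :
    Integrable f sigma := by
  simpa using hf.continuousOn.integrableOn_compact (μ := sigma) isCompact_univ

/-! ### Polar coordinates and parameter integrals over the sphere. -/

section Polar

variable {F : Type*} [NormedAddCommGroup F] [NormedSpace ℝ F]

theorem integral_polar (f : E3 → F) (hf : Integrable f) :
    ∫ x, f x = ∫ r in Set.Ioi (0 : ℝ), r ^ 2 • ∫ θ, f (r • (θ : E3)) ∂sigma := by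
  set g : Metric.sphere (0 : E3) 1 × Set.Ioi (0 : ℝ) → F := fun p => f ((p.2 : ℝ) • (p.1 : E3))
    with hg
  have mp := (volume : Measure E3).measurePreserving_homeomorphUnitSphereProd
  have emb := (homeomorphUnitSphereProd E3).measurableEmbedding
  have hgc : ∀ x : ({(0 : E3)}ᶜ : Set E3), g (homeomorphUnitSphereProd E3 x) = f x := by
    intro x
    have hx : ‖(x : E3)‖ ≠ 0 := norm_ne_zero_iff.2 x.2
    simp [hg, smul_smul, mul_inv_cancel₀ hx]
  have hdim : Module.finrank ℝ E3 - 1 = 2 := by simp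
  rw [hdim] at mp
  have hint : Integrable g (sigma.prod (Measure.volumeIoiPow 2)) := by
    rw [← mp.integrable_comp_emb emb]
    have : g ∘ (homeomorphUnitSphereProd E3) = f ∘ (Subtype.val : ({(0 : E3)}ᶜ : Set E3) → E3) := by
      ext x; exact hgc x
    rw [this, ← integrableOn_iff_comap_subtypeVal (measurableSet_singleton _).compl]
    exact hf.integrableOn
  calc
    ∫ x, f x = ∫ x : ({(0 : E3)}ᶜ : Set E3), f x ∂((volume : Measure E3).comap Subtype.val) := by
      rw [integral_subtype_comap (measurableSet_singleton _).compl f, restrict_compl_singleton]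
    _ = ∫ p, g p ∂(sigma.prod (Measure.volumeIoiPow 2)) := by
      rw [← mp.integral_comp emb]; simp only [hgc]
    _ = ∫ r, ∫ θ, g (θ, r) ∂sigma ∂(Measure.volumeIoiPow 2) := integral_prod_symm _ hint
    _ = _ := by
      simp only [Measure.volumeIoiPow, ENNReal.ofReal]
      rw [integral_withDensity_eq_integral_smul,
        integral_subtype_comap measurableSet_Ioi
          fun a ↦ Real.toNNReal (a ^ 2) • ∫ θ, f (a • (θ : E3)) ∂sigma,
        setIntegral_congr_fun measurableSet_Ioi fun x hx ↦ ?_]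
      · rw [NNReal.smul_def, Real.coe_toNNReal _ (pow_nonneg (le_of_lt hx) _)]
      · exact (measurable_subtype_coe.pow_const _).real_toNNReal

theorem continuous_sphere_integral {X : Type*} [TopologicalSpace X] [FirstCountableTopology X]
    [LocallyCompactSpace X] {f : X → Metric.sphere (0 : E3) 1 → F} (hf : Continuous f.uncurry) :
    Continuous fun x => ∫ θ, f x θ ∂sigma := by
  simpa using continuous_parametric_integral_of_continuous (μ := sigma) hf isCompact_univ

theorem hasDerivAt_sphere_integral {f f' : ℝ → Metric.sphere (0 : E3) 1 → F}
    (hf : Continuous f.uncurry) (hf' : Continuous f'.uncurry)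
    (h : ∀ r θ, HasDerivAt (fun s => f s θ) (f' r θ) r) (r : ℝ) :
    HasDerivAt (fun s => ∫ θ, f s θ ∂sigma) (∫ θ, f' r θ ∂sigma) r := by
  obtain ⟨C, hC⟩ := ((isCompact_Icc (a := r - 1) (b := r + 1)).prod
    (isCompact_univ (X := Metric.sphere (0 : E3) 1))).exists_bound_of_continuousOn
    hf'.continuousOn
  refine (hasDerivAt_integral_of_dominated_loc_of_deriv_le (F := f) (F' := f') (bound := fun _ => C)
    (Icc_mem_nhds (by linarith : r - 1 < r) (by linarith : r < r + 1)) ?_ ?_ ?_ ?_ ?_ ?_).2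
  · exact .of_forall fun s => (integrable_sphere (by fun_prop)).1
  · exact integrable_sphere (by fun_prop)
  · exact (integrable_sphere (by fun_prop)).1
  · exact .of_forall fun θ s hs => hC (s, θ) ⟨hs, trivial⟩
  · exact integrable_const _
  · exact .of_forall fun θ s _ => h s θ

end Polar

/-! ### Divergence theorem and Green's identity on balls. -/

/-- The norm is not smooth at the origin, but a profile supported in (0, ∞) vanishes near there. -/
theorem contDiff_comp_norm {g : ℝ → ℝ} (hg : ContDiff ℝ (⊤ : ℕ∞) g)
    (hs : tsupport g ⊆ Set.Ioi 0) : ContDiff ℝ (⊤ : ℕ∞) fun x : E3 => g ‖x‖ := by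
  rw [contDiff_iff_contDiffAt]
  intro x
  rcases eq_or_ne x 0 with rfl | hx
  · have h0 : ∀ᶠ y in 𝓝 (0 : ℝ), g y = 0 := by
      have : (0 : ℝ) ∉ tsupport g := fun h => lt_irrefl (0 : ℝ) (hs h)
      exact notMem_tsupport_iff_eventuallyEq.1 this
    have h1 : ∀ᶠ y in 𝓝 (0 : E3), g ‖y‖ = 0 :=
      (tendsto_norm_zero (E := E3)).eventually h0
    exact contDiffAt_const.congr_of_eventuallyEq h1
  · exact hg.contDiffAt.comp x (contDiffAt_norm ℝ hx)

theorem fderiv_comp_norm {g : ℝ → ℝ} (hg : ContDiff ℝ (⊤ : ℕ∞) g)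
    {x : E3} (hx : x ≠ 0) (e : E3) :
    fderiv ℝ (fun x : E3 => g ‖x‖) x e = deriv g ‖x‖ * (inner ℝ x e / ‖x‖) := by
  have h2 : HasFDerivAt (fun x : E3 => ‖x‖) (fderiv ℝ (fun x : E3 => ‖x‖) x) x :=
    ((contDiffAt_norm (n := 1) ℝ hx).differentiableAt (by norm_num)).hasFDerivAt
  have h1 := ((hg.differentiable (by simp)) ‖x‖).hasDerivAt
  rw [show (fun x : E3 => g ‖x‖) = g ∘ norm from rfl, (h1.comp_hasFDerivAt x h2).fderiv]
  have h3 : HasFDerivAt (fun x : E3 => ‖x‖ ^ 2) (2 • (innerSL ℝ x)) x :=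
    (hasStrictFDerivAt_norm_sq x).hasFDerivAt
  have h4 := (h2.pow 2).unique h3
  have h5 := congrArg (fun L => L e) h4
  have hn : ‖x‖ ≠ 0 := norm_ne_zero_iff.2 hx
  simp at h5
  simp
  left
  field_simp
  linarith

theorem norm_smul_sphere {r : ℝ} (hr : 0 < r) (θ : Metric.sphere (0 : E3) 1) :
    ‖r • (θ : E3)‖ = r := by
  simp [norm_smul, abs_of_pos hr]

theorem hasDerivAt_ray {G : E3 → ℂ} (hG : ContDiff ℝ 1 G) (y θ : E3) (r : ℝ) :
    HasDerivAt (fun s : ℝ => G (y + s • θ)) (fderiv ℝ G (y + r • θ) θ) r := by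
  have h1 := (hG.differentiable one_ne_zero (y + r • θ)).hasFDerivAt
  have h2 : HasDerivAt (fun s : ℝ => y + s • θ) ((1 : ℝ) • θ) r :=
    ((hasDerivAt_id r).smul_const θ).const_add y
  exact (h1.comp_hasDerivAt r h2).congr_deriv (by simp)

theorem hasDerivAt_sphere_weighted {G : E3 → ℂ} (hG : ContDiff ℝ 1 G) (y e : E3) (r : ℝ) :
    HasDerivAt (fun s : ℝ => ∫ θ, (inner ℝ (θ : E3) e : ℂ) * G (y + s • (θ : E3)) ∂sigma)
      (∫ θ, (inner ℝ (θ : E3) e : ℂ) * fderiv ℝ G (y + r • (θ : E3)) θ ∂sigma) r := by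
  have hc := hG.continuous
  have hc' := hG.continuous_fderiv one_ne_zero
  exact hasDerivAt_sphere_integral
    (f := fun s θ => (inner ℝ (θ : E3) e : ℂ) * G (y + s • (θ : E3)))
    (f' := fun s θ => (inner ℝ (θ : E3) e : ℂ) * fderiv ℝ G (y + s • (θ : E3)) θ)
    (by simp only [Function.uncurry_def]; fun_prop) (by simp only [Function.uncurry_def]; fun_prop)
    (fun r θ => (hasDerivAt_ray hG y θ r).const_mul _) r

/-- Integration by parts in space against a radial cutoff, in polar coordinates. -/
theorem integral_radial_cutoff {V : E3 → ℂ} (hV : ContDiff ℝ 1 V) (e : E3) {g : ℝ → ℝ}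
    (hg : ContDiff ℝ (⊤ : ℕ∞) g) (hgc : HasCompactSupport g) (hs : tsupport g ⊆ Set.Ioi 0) :
    ∫ r in Set.Ioi (0 : ℝ), r ^ 2 • ((g r : ℂ) * ∫ θ, fderiv ℝ V (r • (θ : E3)) e ∂sigma) =
      - ∫ r in Set.Ioi (0 : ℝ), r ^ 2 • (((deriv g r : ℝ) : ℂ) *
        ∫ θ, (inner ℝ (θ : E3) e : ℂ) * V (r • (θ : E3)) ∂sigma) := by
  set η : E3 → ℂ := fun x => ((g ‖x‖ : ℝ) : ℂ) with hη
  have hηs : ContDiff ℝ (⊤ : ℕ∞) η := Complex.ofRealCLM.contDiff.comp (contDiff_comp_norm hg hs)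
  have hηc : HasCompactSupport η := by
    obtain ⟨R, hR⟩ := hgc.isCompact.isBounded.subset_closedBall 0
    refine HasCompactSupport.intro (isCompact_closedBall (0 : E3) R) fun x hx => ?_
    have : ‖x‖ ∉ tsupport g := fun h => hx (by simpa using hR h)
    simp [hη, image_eq_zero_of_notMem_tsupport this]
  have hVc := hV.continuous
  have hVc' := hV.continuous_fderiv one_ne_zero
  have hηc' := hηs.continuous_fderiv (by simp)
  have hηd : ∀ x, x ≠ 0 → fderiv ℝ η x e = ((deriv g ‖x‖ * (inner ℝ x e / ‖x‖) : ℝ) : ℂ) := by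
    intro x hx
    have := (contDiff_comp_norm hg hs).differentiable (by simp) x
    have h2 := (Complex.ofRealCLM.hasFDerivAt.comp x this.hasFDerivAt).fderiv
    rw [← fderiv_comp_norm hg hx e]
    exact congrArg (fun L => L e) h2
  have i1 : Integrable fun x => η x * fderiv ℝ V x e :=
    (by fun_prop : Continuous fun x => η x * fderiv ℝ V x e).integrable_of_hasCompactSupport
      hηc.mul_right
  have i2 : Integrable fun x => fderiv ℝ η x e * V x :=
    (by fun_prop : Continuous fun x => fderiv ℝ η x e * V x).integrable_of_hasCompactSupport
      (hηc.fderiv_apply ℝ e).mul_right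
  have i3 : Integrable fun x => η x * V x :=
    (by fun_prop : Continuous fun x => η x * V x).integrable_of_hasCompactSupport hηc.mul_right
  have key := integral_mul_fderiv_eq_neg_fderiv_mul_of_integrable i2 i1 i3
    (fun x _ => hηs.differentiable (by simp) x) (fun x _ => hV.differentiable one_ne_zero x)
  rw [integral_polar _ i1, integral_polar _ i2] at key
  convert key using 1
  · refine setIntegral_congr_fun measurableSet_Ioi fun r hr => ?_
    simp only [hη, norm_smul_sphere hr, integral_const_mul]
  · congr 1
    refine setIntegral_congr_fun measurableSet_Ioi fun r hr => ?_
    rw [← integral_const_mul]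
    congr 2
    ext θ
    have hr' : (0 : ℝ) < r := hr
    have hn := norm_smul_sphere hr' θ
    rw [hηd _ (by rw [← norm_ne_zero_iff, hn]; exact hr'.ne'), hn, inner_smul_left]
    simp only [conj_trivial]
    rw [mul_div_cancel_left₀ _ hr'.ne']
    push_cast
    ring

/-- The divergence theorem on balls in differential form, for one component of a field. -/
theorem hasDerivAt_sq_mul_flux {V : E3 → ℂ} (hV : ContDiff ℝ 1 V) (e : E3) {r : ℝ} (hr : 0 < r) :
    HasDerivAt (fun s : ℝ => (s : ℂ) ^ 2 * ∫ θ, (inner ℝ (θ : E3) e : ℂ) * V (s • (θ : E3)) ∂sigma)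
      ((r : ℂ) ^ 2 * ∫ θ, fderiv ℝ V (r • (θ : E3)) e ∂sigma) r := by
  have hVc := hV.continuous
  have hVc' := hV.continuous_fderiv one_ne_zero
  set J : ℝ → ℂ := fun s => ∫ θ, (inner ℝ (θ : E3) e : ℂ) * V (s • (θ : E3)) ∂sigma with hJ
  set J' : ℝ → ℂ := fun s =>
    ∫ θ, (inner ℝ (θ : E3) e : ℂ) * fderiv ℝ V (s • (θ : E3)) θ ∂sigma with hJ'
  set D : ℝ → ℂ := fun s => ∫ θ, fderiv ℝ V (s • (θ : E3)) e ∂sigma with hD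
  have dJ : ∀ s, HasDerivAt J (J' s) s := fun s => by
    simpa using hasDerivAt_sphere_weighted hV 0 e s
  have cJ : Continuous J := continuous_iff_continuousAt.2 fun s => (dJ s).continuousAt
  have cJ' : Continuous J' := continuous_sphere_integral (by
    simp only [Function.uncurry_def]; fun_prop)
  have cD : Continuous D := continuous_sphere_integral (by
    simp only [Function.uncurry_def]; fun_prop)
  have dP : ∀ s : ℝ, HasDerivAt (fun s : ℝ => (s : ℂ) ^ 2 * J s)
      (2 * (s : ℂ) * J s + (s : ℂ) ^ 2 * J' s) s := fun s => by
    exact ((((hasDerivAt_id s).ofReal_comp).pow 2).mul (dJ s)).congr_deriv (by simp)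
  set H : ℝ → ℂ := fun s => (s : ℂ) ^ 2 * D s - (2 * (s : ℂ) * J s + (s : ℂ) ^ 2 * J' s) with hH
  have cH : Continuous H := by fun_prop
  -- Against a cutoff g, parts in space turns ∫ g s² D into -∫ g' s² J, and parts in s does the same
  -- to ∫ g (s² J)'. So the defect `H` is orthogonal to every g, and continuity then removes the
  -- "almost everywhere".
  have hae : ∀ᵐ s : ℝ, s ∈ Set.Ioi (0 : ℝ) → H s = 0 := by
    refine isOpen_Ioi.ae_eq_zero_of_integral_contDiff_smul_eq_zero
      (cH.locallyIntegrable.locallyIntegrableOn _) fun g hg hgc hs => ?_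
    have key := integral_radial_cutoff hV e hg hgc hs
    have cg := hg.continuous
    have cg' : Continuous (deriv g) := hg.continuous_deriv (by simp)
    have hgcC : HasCompactSupport fun s => (g s : ℂ) :=
      hgc.comp_left (g := fun t : ℝ => (t : ℂ)) (by simp)
    have hgcC' : HasCompactSupport fun s => ((deriv g s : ℝ) : ℂ) :=
      hgc.deriv.comp_left (g := fun t : ℝ => (t : ℂ)) (by simp)
    have z1 : ∀ s : ℝ, s ∉ Set.Ioi (0 : ℝ) → s ^ 2 • ((g s : ℂ) * D s) = 0 := fun s hs' => by
      rw [image_eq_zero_of_notMem_tsupport fun h => hs' (hs h)]; simp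
    have z2 : ∀ s : ℝ, s ∉ Set.Ioi (0 : ℝ) → s ^ 2 • (((deriv g s : ℝ) : ℂ) * J s) = 0 :=
      fun s hs' => by
        rw [image_eq_zero_of_notMem_tsupport fun h => hs' (hs (tsupport_deriv_subset h))]; simp
    rw [setIntegral_eq_integral_of_forall_compl_eq_zero z1,
      setIntegral_eq_integral_of_forall_compl_eq_zero z2] at key
    have j1 : Integrable fun s : ℝ => (g s : ℂ) * (2 * (s : ℂ) * J s + (s : ℂ) ^ 2 * J' s) :=
      (by fun_prop : Continuous _).integrable_of_hasCompactSupport hgcC.mul_right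
    have j2 : Integrable fun s : ℝ => ((deriv g s : ℝ) : ℂ) * ((s : ℂ) ^ 2 * J s) :=
      (by fun_prop : Continuous _).integrable_of_hasCompactSupport hgcC'.mul_right
    have j3 : Integrable fun s : ℝ => (g s : ℂ) * ((s : ℂ) ^ 2 * J s) :=
      (by fun_prop : Continuous _).integrable_of_hasCompactSupport hgcC.mul_right
    have j4 : Integrable fun s : ℝ => (g s : ℂ) * ((s : ℂ) ^ 2 * D s) :=
      (by fun_prop : Continuous _).integrable_of_hasCompactSupport hgcC.mul_right
    have ibp := integral_mul_deriv_eq_deriv_mul_of_integrable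
      (u := fun s => (g s : ℂ)) (u' := fun s => ((deriv g s : ℝ) : ℂ))
      (fun s _ => ((hg.differentiable (by simp)) s).hasDerivAt.ofReal_comp) (fun s _ => dP s)
      j1 j2 j3
    have e1 : ∀ s, g s • H s = (g s : ℂ) * ((s : ℂ) ^ 2 * D s) -
        (g s : ℂ) * (2 * (s : ℂ) * J s + (s : ℂ) ^ 2 * J' s) := fun s => by
      simp only [hH, Complex.real_smul]; ring
    simp only [e1]
    rw [integral_sub j4 j1, ibp]
    have e2 : ∀ s : ℝ, s ^ 2 • ((g s : ℂ) * D s) = (g s : ℂ) * ((s : ℂ) ^ 2 * D s) := fun s => by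
      rw [Complex.real_smul]; push_cast; ring
    have e3 : ∀ s : ℝ, s ^ 2 • (((deriv g s : ℝ) : ℂ) * J s) = ((deriv g s : ℝ) : ℂ) * ((s : ℂ) ^ 2 * J s) :=
      fun s => by rw [Complex.real_smul]; push_cast; ring
    simp only [e2, e3] at key
    rw [key]; ring
  have hz : H r = 0 := by
    have h1 : Set.EqOn H 0 (Set.Ioi 0) :=
      Measure.eqOn_open_of_ae_eq ((ae_restrict_iff' measurableSet_Ioi).2 hae) isOpen_Ioi
        cH.continuousOn continuousOn_const
    exact h1 hr
  have := dP r
  rwa [← sub_eq_zero.1 hz] at this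

theorem laplacian_eq_sum_fderiv {φ : E3 → ℂ} (hφ : ContDiff ℝ 2 φ) (x : E3) :
    Laplacian.laplacian φ x = ∑ i, fderiv ℝ (fun y => fderiv ℝ φ y (EuclideanSpace.basisFun (Fin 3) ℝ i))
      x (EuclideanSpace.basisFun (Fin 3) ℝ i) := by
  rw [InnerProductSpace.laplacian_eq_iteratedFDeriv_orthonormalBasis φ
    (EuclideanSpace.basisFun (Fin 3) ℝ)]
  refine Finset.sum_congr rfl fun i _ => ?_
  have h1 : DifferentiableAt ℝ (fderiv ℝ φ) x :=
    (hφ.fderiv_right (m := 1) (by norm_num)).differentiable one_ne_zero x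
  rw [iteratedFDeriv_two_apply, fderiv_clm_apply h1 (differentiableAt_const _)]
  simp

theorem continuous_laplacian {φ : E3 → ℂ} (hφ : ContDiff ℝ 2 φ) :
    Continuous (Laplacian.laplacian φ) := by
  have : Laplacian.laplacian φ = fun x => _ := funext (laplacian_eq_sum_fderiv hφ)
  rw [this]
  refine continuous_finsetSum _ fun i _ => ?_
  have h1 : ContDiff ℝ 1 fun y => fderiv ℝ φ y (EuclideanSpace.basisFun (Fin 3) ℝ i) :=
    (hφ.fderiv_right (m := 1) (by norm_num)).clm_apply contDiff_const
  have := h1.continuous_fderiv one_ne_zero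
  fun_prop

theorem sum_inner_mul_apply (L : E3 →L[ℝ] ℂ) (x : E3) :
    ∑ i, ((inner ℝ x (EuclideanSpace.basisFun (Fin 3) ℝ i) : ℝ) : ℂ) *
      L (EuclideanSpace.basisFun (Fin 3) ℝ i) = L x := by
  conv_rhs => rw [← (EuclideanSpace.basisFun (Fin 3) ℝ).sum_repr' x, map_sum]
  refine Finset.sum_congr rfl fun i _ => ?_
  rw [map_smul, Complex.real_smul, real_inner_comm]

/-- Green's first identity on balls in differential form. -/
theorem hasDerivAt_green {a φ : E3 → ℂ} (ha : ContDiff ℝ 1 a) (hφ : ContDiff ℝ 2 φ) (y : E3)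
    {r : ℝ} (hr : 0 < r) :
    HasDerivAt (fun s : ℝ => (s : ℂ) ^ 2 *
        ∫ θ, a (y + s • (θ : E3)) * fderiv ℝ φ (y + s • (θ : E3)) θ ∂sigma)
      ((r : ℂ) ^ 2 * ∫ θ, ((∑ i, fderiv ℝ a (y + r • (θ : E3)) (EuclideanSpace.basisFun (Fin 3) ℝ i) *
        fderiv ℝ φ (y + r • (θ : E3)) (EuclideanSpace.basisFun (Fin 3) ℝ i)) +
        a (y + r • (θ : E3)) * Laplacian.laplacian φ (y + r • (θ : E3))) ∂sigma) r := by
  set b := EuclideanSpace.basisFun (Fin 3) ℝ with hb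
  have hd : ∀ i, ContDiff ℝ 1 fun x => fderiv ℝ φ x (b i) := fun i =>
    (hφ.fderiv_right (m := 1) (by norm_num)).clm_apply contDiff_const
  set V : Fin 3 → E3 → ℂ := fun i x => a (y + x) * fderiv ℝ φ (y + x) (b i) with hV
  have sh : ContDiff ℝ 1 fun x : E3 => y + x := contDiff_const.add contDiff_id
  have hVs : ∀ i, ContDiff ℝ 1 (V i) := fun i => (ha.comp sh).mul ((hd i).comp sh)
  have hVd : ∀ i x, fderiv ℝ (V i) x (b i) = fderiv ℝ a (y + x) (b i) * fderiv ℝ φ (y + x) (b i) +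
      a (y + x) * fderiv ℝ (fun z => fderiv ℝ φ z (b i)) (y + x) (b i) := by
    intro i x
    have e1 : V i = fun x => (fun z => a z * fderiv ℝ φ z (b i)) (y + x) := rfl
    rw [e1, fderiv_comp_add_left (f := fun z => a z * fderiv ℝ φ z (b i)) y,
      fderiv_fun_mul (ha.differentiable one_ne_zero _)
      ((hd i).differentiable one_ne_zero _)]
    simp
    ring
  have ac := ha.continuous
  have hc : Continuous (fderiv ℝ φ) := hφ.continuous_fderiv (by norm_num)
  have Vc : ∀ i, Continuous (V i) := fun i => (hVs i).continuous
  have Vc' : ∀ i, Continuous (fderiv ℝ (V i)) := fun i => (hVs i).continuous_fderiv one_ne_zero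
  have key := HasDerivAt.fun_sum (u := Finset.univ)
    fun i (_ : i ∈ Finset.univ) => hasDerivAt_sq_mul_flux (hVs i) (b i) hr
  have f1 : (fun s : ℝ => (s : ℂ) ^ 2 *
        ∫ θ, a (y + s • (θ : E3)) * fderiv ℝ φ (y + s • (θ : E3)) θ ∂sigma) =
      fun s : ℝ => ∑ i, (s : ℂ) ^ 2 * ∫ θ, (inner ℝ (θ : E3) (b i) : ℂ) * V i (s • (θ : E3)) ∂sigma := by
    ext s
    rw [← Finset.mul_sum, ← integral_finsetSum]
    · congr 2
      ext θ
      rw [← sum_inner_mul_apply _ (θ : E3), Finset.mul_sum]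
      refine Finset.sum_congr rfl fun i _ => ?_
      simp only [hV]; ring
    · intro i _
      have := Vc i
      exact integrable_sphere (by fun_prop)
  rw [f1]
  refine key.congr_deriv ?_
  rw [← Finset.mul_sum, ← integral_finsetSum]
  · congr 2
    ext θ
    simp only [hVd, laplacian_eq_sum_fderiv hφ, Finset.sum_add_distrib, Finset.mul_sum]
    rfl
  · intro i _
    have := Vc' i
    exact integrable_sphere (by fun_prop)

/-! ### Spherical means. -/

/-- The unnormalised spherical mean of `φ` over the sphere of radius `r` about `y`. -/
noncomputable def sphereMean (φ : E3 → ℂ) (y : E3) (r : ℝ) : ℂ :=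
  ∫ θ, φ (y + r • (θ : E3)) ∂sigma

/-- The derivative of `r ↦ r * sphereMean φ y r`. -/
noncomputable def sphereMeanDeriv (φ : E3 → ℂ) (y : E3) (r : ℝ) : ℂ :=
  sphereMean φ y r + r * ∫ θ, fderiv ℝ φ (y + r • (θ : E3)) θ ∂sigma

theorem continuous_sphereMean {φ : E3 → ℂ} (hφ : Continuous φ) (y : E3) :
    Continuous (sphereMean φ y) :=
  continuous_sphere_integral (f := fun (r : ℝ) θ => φ (y + r • (θ : E3)))
    (by simp only [Function.uncurry_def]; fun_prop)

theorem continuous_sphereMeanDeriv {φ : E3 → ℂ} (hφ : ContDiff ℝ 1 φ) (y : E3) :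
    Continuous (sphereMeanDeriv φ y) := by
  have h1 := continuous_sphereMean hφ.continuous y
  have h2 := hφ.continuous_fderiv one_ne_zero
  have h3 : Continuous fun r : ℝ => ∫ θ, fderiv ℝ φ (y + r • (θ : E3)) θ ∂sigma :=
    continuous_sphere_integral (by simp only [Function.uncurry_def]; fun_prop)
  unfold sphereMeanDeriv
  fun_prop

theorem sphereMean_zero (φ : E3 → ℂ) (y : E3) :
    sphereMean φ y 0 = (sigma.real Set.univ : ℂ) * φ y := by
  simp [sphereMean]

theorem sphereMeanDeriv_zero (φ : E3 → ℂ) (y : E3) :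
    sphereMeanDeriv φ y 0 = (sigma.real Set.univ : ℂ) * φ y := by
  rw [← sphereMean_zero]; simp [sphereMeanDeriv]

theorem hasDerivAt_sphereMean {φ : E3 → ℂ} (hφ : ContDiff ℝ 1 φ) (y : E3) (r : ℝ) :
    HasDerivAt (sphereMean φ y) (∫ θ, fderiv ℝ φ (y + r • (θ : E3)) θ ∂sigma) r := by
  have hc := hφ.continuous
  have hc' := hφ.continuous_fderiv one_ne_zero
  exact hasDerivAt_sphere_integral (f := fun s θ => φ (y + s • (θ : E3)))
    (f' := fun s θ => fderiv ℝ φ (y + s • (θ : E3)) θ)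
    (by simp only [Function.uncurry_def]; fun_prop) (by simp only [Function.uncurry_def]; fun_prop)
    (fun r θ => hasDerivAt_ray hφ y θ r) r

theorem hasDerivAt_mul_sphereMean {φ : E3 → ℂ} (hφ : ContDiff ℝ 1 φ) (y : E3) (r : ℝ) :
    HasDerivAt (fun s : ℝ => (s : ℂ) * sphereMean φ y s) (sphereMeanDeriv φ y r) r :=
  (((hasDerivAt_id r).ofReal_comp).mul (hasDerivAt_sphereMean hφ y r)).congr_deriv
    (by simp [sphereMeanDeriv])

/-- Darboux's equation. -/
theorem hasDerivAt_sphereMeanDeriv {φ : E3 → ℂ} (hφ : ContDiff ℝ 2 φ) (y : E3) {r : ℝ}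
    (hr : 0 < r) :
    HasDerivAt (sphereMeanDeriv φ y) (r * sphereMean (Laplacian.laplacian φ) y r) r := by
  have h1 : ContDiff ℝ 1 φ := hφ.of_le (by norm_num)
  set N : ℝ → ℂ := fun r => ∫ θ, fderiv ℝ φ (y + r • (θ : E3)) θ ∂sigma with hN
  have g := hasDerivAt_green (a := fun _ => 1) contDiff_const hφ y hr
  simp only [one_mul, fderiv_fun_const, Pi.zero_apply, zero_mul, zero_apply,
    Finset.sum_const_zero, zero_add] at g
  have hr' : (r : ℂ) ≠ 0 := by exact_mod_cast hr.ne'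
  have q := g.div ((hasDerivAt_id r).ofReal_comp) hr'
  have m := hasDerivAt_sphereMean h1 y r
  have e : sphereMeanDeriv φ y =ᶠ[𝓝 r] fun s : ℝ => sphereMean φ y s + (s : ℂ) ^ 2 * N s / s := by
    filter_upwards [lt_mem_nhds hr] with s hs
    have : (s : ℂ) ≠ 0 := by exact_mod_cast hs.ne'
    simp only [sphereMeanDeriv]
    field_simp
    rfl
  refine HasDerivAt.congr_of_eventuallyEq ?_ e
  refine (m.add q).congr_deriv ?_
  simp only [id, sphereMean]
  field_simp
  push_cast
  ring

/-- By Darboux's equation p = s·M solves p'' = -k²p with p(0) = 0 and p'(0) = ω v(y). -/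
theorem sphereMean_of_helmholtz {k : ℝ} {v : E3 → ℂ} (hv : ContDiff ℝ 2 v)
    (hH : ∀ x, Laplacian.laplacian v x + (k : ℂ) ^ 2 * v x = 0) (y : E3) {r : ℝ} (hr : 0 ≤ r) :
    (k : ℂ) * (r * sphereMean v y r) = Complex.sin (k * r) * ((sigma.real Set.univ : ℂ) * v y) := by
  have hv1 : ContDiff ℝ 1 v := hv.of_le (by norm_num)
  set p : ℝ → ℂ := fun s => (s : ℂ) * sphereMean v y s with hp
  set q : ℝ → ℂ := sphereMeanDeriv v y with hq
  have cq : Continuous q := continuous_sphereMeanDeriv hv1 y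
  have cM : Continuous (sphereMean v y) := continuous_sphereMean hv.continuous y
  have dp : ∀ s, HasDerivAt p (q s) s := hasDerivAt_mul_sphereMean hv1 y
  have hΔ : Laplacian.laplacian v = fun x => -(k : ℂ) ^ 2 * v x := by
    ext x; linear_combination hH x
  have dq : ∀ s, 0 < s → HasDerivAt q (-(k : ℂ) ^ 2 * p s) s := fun s hs => by
    refine (hasDerivAt_sphereMeanDeriv hv y hs).congr_deriv ?_
    simp only [hΔ, sphereMean, hp, integral_const_mul]
    ring
  have dl : ∀ s : ℝ, HasDerivAt (fun s : ℝ => (k : ℂ) * (s : ℂ)) k s := fun s => by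
    simpa using ((hasDerivAt_id s).ofReal_comp).const_mul (k : ℂ)
  have dsin : ∀ s : ℝ, HasDerivAt (fun s : ℝ => Complex.sin (k * s)) (Complex.cos (k * s) * k) s :=
    fun s => (Complex.hasDerivAt_sin _).comp s (dl s)
  have dcos : ∀ s : ℝ, HasDerivAt (fun s : ℝ => Complex.cos (k * s)) (-Complex.sin (k * s) * k) s :=
    fun s => (Complex.hasDerivAt_cos _).comp s (dl s)
  -- The second-order equation is known only for s > 0, so the value at 0 is reached through
  -- continuity.
  have const : ∀ f : ℝ → ℂ, Continuous f → (∀ s, 0 < s → HasDerivAt f 0 s) → f r = f 0 := by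
    intro f hf hd
    have := intervalIntegral.integral_eq_sub_of_hasDerivAt_of_le hr hf.continuousOn
      (fun s hs => hd s hs.1) intervalIntegrable_const
    rw [intervalIntegral.integral_zero] at this
    exact (sub_eq_zero.1 this.symm)
  have cp : Continuous p := by fun_prop
  -- The two first integrals of p'' = -k²p: (kp, p') rotated back by the angle ks. Combining them
  -- isolates kp(r).
  have hα := const (fun s => q s * Complex.sin (k * s) - k * p s * Complex.cos (k * s))
    (by fun_prop) fun s hs => by
      refine (((dq s hs).mul (dsin s)).sub (((dp s).const_mul (k : ℂ)).mul (dcos s))).congr_deriv ?_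
      ring
  have hβ := const (fun s => q s * Complex.cos (k * s) + k * p s * Complex.sin (k * s))
    (by fun_prop) fun s hs => by
      refine (((dq s hs).mul (dcos s)).add (((dp s).const_mul (k : ℂ)).mul (dsin s))).congr_deriv ?_
      ring
  have hp0 : p 0 = 0 := by simp [hp]
  have hq0 : q 0 = (sigma.real Set.univ : ℂ) * v y := sphereMeanDeriv_zero v y
  simp only [hp0, Complex.ofReal_zero, mul_zero, Complex.sin_zero, Complex.cos_zero,
    sub_zero, mul_one, add_zero, hq0] at hα hβ
  have hsc := Complex.sin_sq_add_cos_sq ((k : ℂ) * r)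
  change (k : ℂ) * p r = _
  linear_combination Complex.sin (k * r) * hβ - Complex.cos (k * r) * hα - (k * p r) * hsc

/-! ### L² growth and vanishing of radiating entire solutions. -/

/-- Green's identity with the weight conj v: the divergence of conj v ∇v is |∇v|² - k²|v|², which is
real, so the imaginary part of the flux is constant in r, and it is zero at r = 0. -/
theorem im_flux_eq_zero {k : ℝ} {v : E3 → ℂ} (hv : ContDiff ℝ 2 v)
    (hH : ∀ x, Laplacian.laplacian v x + (k : ℂ) ^ 2 * v x = 0) {r : ℝ} (hr : 0 < r) :
    (∫ θ, (starRingEnd ℂ) (v (r • (θ : E3))) * fderiv ℝ v (r • (θ : E3)) θ ∂sigma).im = 0 := by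
  have hv1 : ContDiff ℝ 1 v := hv.of_le (by norm_num)
  have vc := hv.continuous
  have vc' := hv1.continuous_fderiv one_ne_zero
  set a : E3 → ℂ := fun x => (starRingEnd ℂ) (v x) with ha
  have has : ContDiff ℝ 1 a := Complex.conjCLE.contDiff.comp hv1
  have had : ∀ x e, fderiv ℝ a x e = (starRingEnd ℂ) (fderiv ℝ v x e) := fun x e => by
    have := (Complex.conjCLE.toContinuousLinearMap.hasFDerivAt.comp x
      (hv1.differentiable one_ne_zero x).hasFDerivAt).fderiv
    exact congrArg (fun L => L e) this
  set f : ℝ → ℂ := fun s => (s : ℂ) ^ 2 * ∫ θ, a (s • (θ : E3)) * fderiv ℝ v (s • (θ : E3)) θ ∂sigma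
    with hf
  have cf : Continuous f := by
    have : Continuous fun s : ℝ => ∫ θ, a (s • (θ : E3)) * fderiv ℝ v (s • (θ : E3)) θ ∂sigma := by
      have := has.continuous
      exact continuous_sphere_integral (by simp only [Function.uncurry_def]; fun_prop)
    fun_prop
  have df : ∀ s, 0 < s → HasDerivAt (fun s => (f s).im) 0 s := by
    intro s hs
    have g := hasDerivAt_green has hv 0 hs
    simp only [zero_add] at g
    refine (Complex.imCLM.hasFDerivAt.comp_hasDerivAt s g).congr_deriv ?_
    rw [Complex.imCLM_apply, ← Complex.ofReal_pow, Complex.im_ofReal_mul]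
    refine mul_eq_zero_of_right _ ?_
    have hreal : ∀ x : E3, ((∑ i, fderiv ℝ a x (EuclideanSpace.basisFun (Fin 3) ℝ i) *
        fderiv ℝ v x (EuclideanSpace.basisFun (Fin 3) ℝ i)) + a x * Laplacian.laplacian v x) =
        (((∑ i, Complex.normSq (fderiv ℝ v x (EuclideanSpace.basisFun (Fin 3) ℝ i))) -
          k ^ 2 * Complex.normSq (v x) : ℝ) : ℂ) := by
      intro x
      have h1 : Laplacian.laplacian v x = -(k : ℂ) ^ 2 * v x := by linear_combination hH x
      rw [h1]
      have hax : a x = (starRingEnd ℂ) (v x) := rfl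
      simp only [had, hax]
      push_cast
      simp only [Complex.normSq_eq_conj_mul_self]
      ring
    simp only [hreal]
    rw [integral_complex_ofReal, Complex.ofReal_im]
  have := intervalIntegral.integral_eq_sub_of_hasDerivAt_of_le hr.le
    (Complex.continuous_im.comp cf).continuousOn (fun s hs => df s hs.1) intervalIntegrable_const
  rw [intervalIntegral.integral_zero] at this
  have h0 : (f r).im = 0 := by
    have h1 : (f 0).im = 0 := by simp [hf]
    have h2 : (0 : ℝ) = (f r).im - (f 0).im := this
    linarith
  rw [hf] at h0
  simp only at h0
  rw [← Complex.ofReal_pow, Complex.im_ofReal_mul] at h0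
  exact (mul_eq_zero.1 h0).resolve_left (by positivity)

theorem sphere_l2_le {k : ℝ} (hk : 0 < k) {v : E3 → ℂ} (hv : ContDiff ℝ 2 v)
    (hH : ∀ x, Laplacian.laplacian v x + (k : ℂ) ^ 2 * v x = 0)
    (hS : Tendsto (fun x : E3 => (‖x‖ : ℂ) * (fderiv ℝ v x (‖x‖⁻¹ • x) - Complex.I * (k : ℂ) * v x))
      (Bornology.cobounded E3) (𝓝 0)) {ε : ℝ} (hε : 0 < ε) :
    ∃ T > 0, ∀ r ≥ T, r ^ 2 * ∫ θ, ‖v (r • (θ : E3))‖ ^ 2 ∂sigma ≤ ε := by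
  have hv1 : ContDiff ℝ 1 v := hv.of_le (by norm_num)
  have vc := hv.continuous
  have vc' := hv1.continuous_fderiv one_ne_zero
  set ω := sigma.real Set.univ with hω
  have hω0 : 0 ≤ ω := measureReal_nonneg
  -- Chosen so that ω δ² ≤ k² ε. The 1 in the denominator keeps it positive without using ω > 0.
  set δ := Real.sqrt (k ^ 2 * ε / (ω + 1)) with hδ
  have hδ0 : 0 < δ := Real.sqrt_pos.2 (by positivity)
  have hδ2 : δ ^ 2 = k ^ 2 * ε / (ω + 1) := Real.sq_sqrt (by positivity)
  have hev := hS.eventually (Metric.ball_mem_nhds 0 hδ0)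
  rw [← comap_norm_atTop, eventually_comap] at hev
  obtain ⟨T, hT⟩ := eventually_atTop.1 hev
  refine ⟨max T 1, by positivity, fun r hr => ?_⟩
  have hr0 : 0 < r := lt_of_lt_of_le one_pos ((le_max_right _ _).trans hr)
  -- Expand |D - ikw|² = |D|² + k²|w|² - 2k Im(conj w · D) and drop |D|². After integration the
  -- cross term is the flux that vanishes.
  have hpt : ∀ θ : Metric.sphere (0 : E3) 1, k ^ 2 * r ^ 2 * ‖v (r • (θ : E3))‖ ^ 2 ≤
      δ ^ 2 + 2 * k * r ^ 2 *
        ((starRingEnd ℂ) (v (r • (θ : E3))) * fderiv ℝ v (r • (θ : E3)) θ).im := by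
    intro θ
    have hn := norm_smul_sphere hr0 θ
    have h1 := hT r ((le_max_left _ _).trans hr) (r • (θ : E3)) hn
    rw [dist_zero_right, hn, smul_smul, inv_mul_cancel₀ hr0.ne', one_smul] at h1
    set D := fderiv ℝ v (r • (θ : E3)) θ
    set w := v (r • (θ : E3))
    have h2 : ‖(r : ℂ) * (D - Complex.I * k * w)‖ ^ 2 ≤ δ ^ 2 := by gcongr
    rw [← Complex.normSq_eq_norm_sq] at h2 ⊢
    simp only [Complex.normSq_apply, Complex.mul_re, Complex.mul_im, Complex.sub_re, Complex.sub_im,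
      Complex.ofReal_re, Complex.ofReal_im, Complex.I_re, Complex.I_im, Complex.conj_re,
      Complex.conj_im] at h2 ⊢
    nlinarith [mul_nonneg (sq_nonneg r) (add_nonneg (sq_nonneg D.re) (sq_nonneg D.im))]
  have cI : Continuous fun θ : Metric.sphere (0 : E3) 1 =>
      (starRingEnd ℂ) (v (r • (θ : E3))) * fderiv ℝ v (r • (θ : E3)) θ := by
    have := Complex.continuous_conj
    fun_prop
  have hint := integral_mono (μ := sigma) (integrable_sphere (by fun_prop))
    (integrable_sphere (by fun_prop)) hpt
  rw [integral_const_mul, integral_add (integrable_const _) (integrable_sphere (by fun_prop)),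
    integral_const_mul, integral_const, smul_eq_mul] at hint
  have him := im_flux_eq_zero hv hH hr0
  have hcomm := Complex.imCLM.integral_comp_comm (integrable_sphere cI)
  simp only [Complex.imCLM_apply] at hcomm
  rw [hcomm, him, mul_zero, add_zero, hδ2, ← hω] at hint
  have h3 : ω * (k ^ 2 * ε / (ω + 1)) ≤ k ^ 2 * ε := by
    rw [← mul_div_assoc, div_le_iff₀ (by positivity)]
    nlinarith [mul_pos (pow_pos hk 2) hε]
  have hk2 : 0 < k ^ 2 := by positivity
  refine le_of_mul_le_mul_left ?_ hk2
  rw [← mul_assoc]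
  exact hint.trans h3

theorem setIntegral_closedBall_polar {F : Type*} [NormedAddCommGroup F] [NormedSpace ℝ F]
    {h : E3 → F} (hh : Continuous h) (y : E3) {R : ℝ} (hR : 0 ≤ R) :
    ∫ x in Metric.closedBall y R, h x =
      ∫ r in (0 : ℝ)..R, r ^ 2 • ∫ θ, h (y + r • (θ : E3)) ∂sigma := by
  have hm : MeasurableSet (Metric.closedBall y R) := Metric.isClosed_closedBall.measurableSet
  have hi : Integrable ((Metric.closedBall y R).indicator h) :=
    (hh.continuousOn.integrableOn_compact (isCompact_closedBall y R)).integrable_indicator hm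
  rw [← integral_indicator hm, ← integral_add_left_eq_self _ y, integral_polar _ (hi.comp_add_left y),
    intervalIntegral.integral_of_le hR, ← Set.Ioi_inter_Iic,
    ← setIntegral_indicator measurableSet_Iic]
  refine setIntegral_congr_fun measurableSet_Ioi fun r hr => ?_
  have hmem : ∀ θ : Metric.sphere (0 : E3) 1,
      y + r • (θ : E3) ∈ Metric.closedBall y R ↔ r ∈ Set.Iic R := fun θ => by
    rw [mem_closedBall_iff_norm, add_sub_cancel_left, norm_smul_sphere hr, Set.mem_Iic]
  by_cases hrR : r ∈ Set.Iic R
  · simp [Set.indicator_of_mem hrR, Set.indicator_of_mem ((hmem _).2 hrR)]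
  · simp [Set.indicator_of_notMem hrR, Set.indicator_of_notMem (fun h => hrR ((hmem _).1 h))]

/-- Cauchy–Schwarz against the constant 1, read off from the nonnegative variance of ‖f‖. -/
theorem sq_norm_integral_sphere_le {f : Metric.sphere (0 : E3) 1 → ℂ} (hf : Continuous f) :
    ‖∫ θ, f θ ∂sigma‖ ^ 2 ≤ sigma.real Set.univ * ∫ θ, ‖f θ‖ ^ 2 ∂sigma := by
  set ω := sigma.real Set.univ with hω
  set A := ∫ θ, ‖f θ‖ ∂sigma with hA
  have h1 : ‖∫ θ, f θ ∂sigma‖ ≤ A := norm_integral_le_integral_norm _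
  have hω0 : 0 ≤ ω := measureReal_nonneg
  have h2 : 0 ≤ ∫ θ, (ω * ‖f θ‖ - A) ^ 2 ∂sigma := integral_nonneg fun _ => sq_nonneg _
  have h3 : ∫ θ, (ω * ‖f θ‖ - A) ^ 2 ∂sigma = ω * (ω * ∫ θ, ‖f θ‖ ^ 2 ∂sigma - A ^ 2) := by
    have e : ∀ θ, (ω * ‖f θ‖ - A) ^ 2 = ω ^ 2 * ‖f θ‖ ^ 2 - 2 * ω * A * ‖f θ‖ + A ^ 2 :=
      fun θ => by ring
    simp only [e]
    rw [integral_add (integrable_sphere (by fun_prop)) (integrable_const _),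
      integral_sub (integrable_sphere (by fun_prop)) (integrable_sphere (by fun_prop)),
      integral_const_mul, integral_const_mul, integral_const, smul_eq_mul]
    ring
  rw [h3] at h2
  rcases hω0.eq_or_lt with h0 | h0
  · have : (sigma : Measure (Metric.sphere (0 : E3) 1)) = 0 := by
      rw [← Measure.measure_univ_eq_zero]
      exact (measureReal_eq_zero_iff).1 h0.symm
    rw [this]; simp
  · have h4 : 0 ≤ ω * ∫ θ, ‖f θ‖ ^ 2 ∂sigma - A ^ 2 := by
      by_contra hneg
      nlinarith
    have h5 : ‖∫ θ, f θ ∂sigma‖ ^ 2 ≤ A ^ 2 := by gcongr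
    linarith

theorem sigma_univ_pos : 0 < sigma.real Set.univ := by
  have h1 : (sigma : Measure (Metric.sphere (0 : E3) 1)) ≠ 0 := Measure.toSphere_ne_zero _
  have : NeZero (sigma : Measure (Metric.sphere (0 : E3) 1)) := ⟨h1⟩
  exact measureReal_univ_pos

theorem integral_sin_mul_sq_ge {k : ℝ} (hk : 0 < k) (R : ℝ) :
    R / 2 - 1 / (2 * k) ≤ ∫ r in (0 : ℝ)..R, Real.sin (k * r) ^ 2 := by
  rw [intervalIntegral.integral_comp_mul_left (fun x => Real.sin x ^ 2) hk.ne', integral_sin_sq]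
  simp only [mul_zero, Real.sin_zero, zero_mul, zero_sub, sub_zero, smul_eq_mul]
  have h : Real.sin (k * R) * Real.cos (k * R) ≤ 1 := by
    nlinarith [Real.sin_sq_add_cos_sq (k * R), sq_nonneg (Real.sin (k * R) - Real.cos (k * R))]
  have e : R / 2 - 1 / (2 * k) = k⁻¹ * ((-1 + k * R) / 2) := by field_simp; ring
  rw [e]
  gcongr

/-- A classical solution of the Helmholtz equation in the whole space that satisfies the
Sommerfeld condition vanishes. -/
theorem eq_zero_of_helmholtz_of_sommerfeld {k : ℝ} (hk : 0 < k) {v : E3 → ℂ} (hv : ContDiff ℝ 2 v)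
    (hH : ∀ x, Laplacian.laplacian v x + (k : ℂ) ^ 2 * v x = 0)
    (hS : Tendsto (fun x : E3 => (‖x‖ : ℂ) * (fderiv ℝ v x (‖x‖⁻¹ • x) - Complex.I * (k : ℂ) * v x))
      (Bornology.cobounded E3) (𝓝 0)) (y : E3) : v y = 0 := by
  have vc := hv.continuous
  set ω := sigma.real Set.univ with hω
  have hω0 : 0 < ω := sigma_univ_pos
  by_contra hne
  -- Cauchy–Schwarz and the mean value formula give `N y r` ≥ A sin²(kr), whose integral grows at
  -- rate A/2. The upper bound is arranged to grow only at rate A/4.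
  set A := ω * ‖v y‖ ^ 2 / k ^ 2 with hA
  have hA0 : 0 < A := by have := norm_pos_iff.2 hne; positivity
  obtain ⟨T, hT0, hT⟩ := sphere_l2_le hk hv hH hS (ε := A / 4) (by positivity)
  set N : E3 → ℝ → ℝ := fun z r => r ^ 2 * ∫ θ, ‖v (z + r • (θ : E3))‖ ^ 2 ∂sigma with hN
  have cN : ∀ z, Continuous (N z) := fun z => by
    have : Continuous fun r : ℝ => ∫ θ, ‖v (z + r • (θ : E3))‖ ^ 2 ∂sigma :=
      continuous_sphere_integral (by simp only [Function.uncurry_def]; fun_prop)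
    fun_prop
  have hball : ∀ z, ∀ R, 0 ≤ R →
      ∫ x in Metric.closedBall z R, ‖v x‖ ^ 2 = ∫ r in (0 : ℝ)..R, N z r := fun z R hR =>
    setIntegral_closedBall_polar (h := fun x => ‖v x‖ ^ 2) (by fun_prop) z hR
  set C := ∫ r in (0 : ℝ)..T, N 0 r with hC
  have upper : ∀ R, T ≤ R → ∫ r in (0 : ℝ)..R, N 0 r ≤ C + A / 4 * R := by
    intro R hR
    rw [← intervalIntegral.integral_add_adjacent_intervals ((cN 0).intervalIntegrable 0 T)
      ((cN 0).intervalIntegrable T R)]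
    have h1 : ∫ r in T..R, N 0 r ≤ ∫ r in T..R, A / 4 := by
      refine intervalIntegral.integral_mono_on hR ((cN 0).intervalIntegrable _ _)
        intervalIntegrable_const fun r hr => ?_
      simpa [hN] using hT r hr.1
    rw [intervalIntegral.integral_const, smul_eq_mul] at h1
    nlinarith
  have lower : ∀ R, 0 ≤ R → A * (R / 2 - 1 / (2 * k)) ≤ ∫ r in (0 : ℝ)..R, N y r := by
    intro R hR
    have h1 : ∫ r in (0 : ℝ)..R, A * Real.sin (k * r) ^ 2 ≤ ∫ r in (0 : ℝ)..R, N y r := by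
      refine intervalIntegral.integral_mono_on hR
        ((by fun_prop : Continuous _).intervalIntegrable _ _)
        ((cN y).intervalIntegrable _ _) fun r hr => ?_
      have h2 := sq_norm_integral_sphere_le (f := fun θ => v (y + r • (θ : E3))) (by fun_prop)
      have h3 := congrArg (fun z : ℂ => ‖z‖ ^ 2) (sphereMean_of_helmholtz hv hH y hr.1)
      have h4 : ‖Complex.sin (k * r)‖ ^ 2 = Real.sin (k * r) ^ 2 := by
        rw [← Complex.ofReal_mul, ← Complex.ofReal_sin, Complex.norm_real, Real.norm_eq_abs, sq_abs]
      simp only [norm_mul, mul_pow, h4, Complex.norm_real, Real.norm_eq_abs, sq_abs] at h3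
      rw [← hω] at h3 h2
      have h5 : r ^ 2 * ‖sphereMean v y r‖ ^ 2 ≤ ω * N y r := by
        simp only [hN]
        calc r ^ 2 * ‖sphereMean v y r‖ ^ 2 ≤ r ^ 2 * (ω * ∫ θ, ‖v (y + r • (θ : E3))‖ ^ 2 ∂sigma) := by
              gcongr; exact h2
          _ = _ := by ring
      refine le_of_mul_le_mul_left ?_ hω0
      refine le_trans (le_of_eq ?_) h5
      simp only [hA]
      field_simp
      linarith
    rw [intervalIntegral.integral_const_mul] at h1
    exact (mul_le_mul_of_nonneg_left (integral_sin_mul_sq_ge hk R) hA0.le).trans h1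
  -- The two bounds have different centres; the ball of radius R about y lies in the one of radius R
  -- + ‖y‖ about 0.
  have main : ∀ R, T ≤ R → A * (R / 2 - 1 / (2 * k)) ≤ C + A / 4 * (R + ‖y‖) := by
    intro R hR
    have hR0 : 0 ≤ R := hT0.le.trans hR
    have hy := norm_nonneg y
    refine (lower R hR0).trans ((le_trans ?_) (upper (R + ‖y‖) (by linarith)))
    rw [← hball y R hR0, ← hball 0 _ (by positivity)]
    refine setIntegral_mono_set ?_ (.of_forall fun _ => sq_nonneg _) (Eventually.of_forall ?_)
    · exact (by fun_prop : Continuous fun x => ‖v x‖ ^ 2).continuousOn.integrableOn_compact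
        (isCompact_closedBall _ _)
    · exact Metric.closedBall_subset_closedBall' (by simp [dist_zero_right])
  -- `main` now reads A R/2 ≤ A R/4 + B, which fails once A R ≥ 4B + 1.
  set B := C + A / 4 * ‖y‖ + A * (1 / (2 * k)) with hB
  have hlast := main (max T ((4 * B + 1) / A)) (le_max_left _ _)
  have h6 : (4 * B + 1) / A ≤ max T ((4 * B + 1) / A) := le_max_right _ _
  rw [div_le_iff₀ hA0] at h6
  nlinarith

/-! ### Convolution and Weyl's lemma. -/

open scoped Convolution

/-- Convolution of complex-valued functions on `E3`. -/
noncomputable abbrev cconv (f g : E3 → ℂ) : E3 → ℂ :=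
  f ⋆[ContinuousLinearMap.mul ℝ ℂ, volume] g

theorem cconv_comm (f g : E3 → ℂ) : cconv f g = cconv g f := by
  rw [cconv, cconv, ← convolution_flip, ContinuousLinearMap.flip_mul]

/-- The distribution `w` need not decay; compact support of the other two factors supplies all
integrability. -/
theorem cconv_assoc {w f g : E3 → ℂ} (hw : LocallyIntegrable w) (hf : Continuous f)
    (hg : Continuous g) (hfc : HasCompactSupport f) (hgc : HasCompactSupport g) :
    cconv (cconv w f) g = cconv w (cconv f g) := by
  ext x
  have hwn : LocallyIntegrable fun x => ‖w x‖ := fun x => (hw x).norm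
  refine convolution_assoc _ _ _ _ (fun a b c => mul_assoc a b c) hw.aestronglyMeasurable
    hf.aestronglyMeasurable hg.aestronglyMeasurable
    (.of_forall (hfc.convolutionExists_right _ hw hf))
    (.of_forall (hgc.norm.convolutionExists_right _ hf.norm.locallyIntegrable hg.norm)) ?_
  exact (hfc.norm.convolution _ hgc.norm).convolutionExists_right _ hwn
    (hgc.norm.continuous_convolution_right _ hf.norm.locallyIntegrable hg.norm) x

theorem contDiff_cconv {w ρ : E3 → ℂ} (hw : LocallyIntegrable w) (hρ : ContDiff ℝ (⊤ : ℕ∞) ρ)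
    (hc : HasCompactSupport ρ) : ContDiff ℝ (⊤ : ℕ∞) (cconv w ρ) :=
  hc.contDiff_convolution_right _ hw hρ

theorem fderiv_cconv {w ρ : E3 → ℂ} (hw : LocallyIntegrable w) (hρ : ContDiff ℝ (⊤ : ℕ∞) ρ)
    (hc : HasCompactSupport ρ) (x e : E3) :
    fderiv ℝ (cconv w ρ) x e = cconv w (fun z => fderiv ℝ ρ z e) x := by
  rw [(hc.hasFDerivAt_convolution_right (ContinuousLinearMap.mul ℝ ℂ) hw
    (hρ.of_le (by exact_mod_cast le_top)) x).fderiv]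
  exact convolution_precompR_apply _ hw (hc.fderiv ℝ) (hρ.continuous_fderiv (by simp)) x e

theorem contDiff_fderiv_apply {ρ : E3 → ℂ} (hρ : ContDiff ℝ (⊤ : ℕ∞) ρ) (e : E3) :
    ContDiff ℝ (⊤ : ℕ∞) fun z => fderiv ℝ ρ z e :=
  (hρ.fderiv_right (m := (⊤ : ℕ∞)) (by exact_mod_cast le_top)).clm_apply contDiff_const

theorem laplacian_cconv {w ρ : E3 → ℂ} (hw : LocallyIntegrable w) (hρ : ContDiff ℝ (⊤ : ℕ∞) ρ)
    (hc : HasCompactSupport ρ) (x : E3) :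
    Laplacian.laplacian (cconv w ρ) x = cconv w (Laplacian.laplacian ρ) x := by
  have h2 : (2 : WithTop ℕ∞) ≤ ((⊤ : ℕ∞) : WithTop ℕ∞) :=
    WithTop.coe_le_coe.2 (le_top : (2 : ℕ∞) ≤ ⊤)
  set b := EuclideanSpace.basisFun (Fin 3) ℝ with hb
  rw [laplacian_eq_sum_fderiv ((contDiff_cconv hw hρ hc).of_le h2)]
  have e1 : ∀ i, (fun y => fderiv ℝ (cconv w ρ) y (b i)) = cconv w (fun z => fderiv ℝ ρ z (b i)) :=
    fun i => funext fun y => fderiv_cconv hw hρ hc y (b i)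
  have hd := fun i => contDiff_fderiv_apply hρ (b i)
  have hdc := fun i => hc.fderiv_apply ℝ (b i)
  have hd2 := fun i => contDiff_fderiv_apply (hd i) (b i)
  have hdc2 := fun i => (hdc i).fderiv_apply ℝ (b i)
  simp only [← hb, e1]
  rw [Finset.sum_congr rfl fun i _ => fderiv_cconv hw (hd i) (hdc i) x (b i)]
  simp only [cconv, convolution_def]
  rw [← integral_finsetSum _ fun i _ => (hdc2 i).convolutionExists_right
    (ContinuousLinearMap.mul ℝ ℂ) hw (hd2 i).continuous x]
  congr 1
  ext t
  rw [laplacian_eq_sum_fderiv (hρ.of_le h2), map_sum]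

theorem fderiv_comp_const_sub_apply (f : E3 → ℂ) (hf : Differentiable ℝ f) (x y e : E3) :
    fderiv ℝ (fun z => f (x - z)) y e = -fderiv ℝ f (x - y) e := by
  have h1 : HasFDerivAt (fun z : E3 => x - z) (-ContinuousLinearMap.id ℝ E3) y :=
    (hasFDerivAt_id y).const_sub x
  have := ((hf (x - y)).hasFDerivAt.comp y h1).fderiv
  have h2 := congrArg (fun L => L e) this
  refine h2.trans (by simp)

theorem laplacian_comp_const_sub {ρ : E3 → ℂ} (hρ : ContDiff ℝ (⊤ : ℕ∞) ρ) (x y : E3) :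
    Laplacian.laplacian (fun z => ρ (x - z)) y = Laplacian.laplacian ρ (x - y) := by
  have h2 : (2 : WithTop ℕ∞) ≤ ((⊤ : ℕ∞) : WithTop ℕ∞) :=
    WithTop.coe_le_coe.2 (le_top : (2 : ℕ∞) ≤ ⊤)
  have hs : ContDiff ℝ (⊤ : ℕ∞) fun z => ρ (x - z) := hρ.comp (contDiff_const.sub contDiff_id)
  rw [laplacian_eq_sum_fderiv (hρ.of_le h2), laplacian_eq_sum_fderiv (hs.of_le h2)]
  refine Finset.sum_congr rfl fun i _ => ?_
  set e := EuclideanSpace.basisFun (Fin 3) ℝ i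
  simp only [fderiv_comp_const_sub_apply ρ (hρ.differentiable (by simp))]
  have hd := contDiff_fderiv_apply hρ e
  rw [fderiv_fun_neg, neg_apply,
    fderiv_comp_const_sub_apply (fun z => fderiv ℝ ρ z e) (hd.differentiable (by simp)), neg_neg]

theorem hasCompactSupport_laplacian {ρ : E3 → ℂ} (hρ : ContDiff ℝ (⊤ : ℕ∞) ρ)
    (hc : HasCompactSupport ρ) : HasCompactSupport (Laplacian.laplacian ρ) := by
  have h2 : (2 : WithTop ℕ∞) ≤ ((⊤ : ℕ∞) : WithTop ℕ∞) :=
    WithTop.coe_le_coe.2 (le_top : (2 : ℕ∞) ≤ ⊤)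
  refine hc.mono' fun z hz => ?_
  by_contra hz'
  apply hz
  rw [laplacian_eq_sum_fderiv (hρ.of_le h2)]
  refine Finset.sum_eq_zero fun i _ => ?_
  set e := EuclideanSpace.basisFun (Fin 3) ℝ i
  have h1 : z ∉ tsupport fun y => fderiv ℝ ρ y e :=
    fun h => hz' (tsupport_fderiv_apply_subset ℝ e h)
  have h3 : fderiv ℝ (fun y => fderiv ℝ ρ y e) z = 0 := by
    rw [(notMem_tsupport_iff_eventuallyEq.1 h1).fderiv_eq]
    simp
  rw [h3]; simp

/-- Derivatives fall on ρ, and the resulting integral is the weak equation tested with z ↦ ρ(x - z).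
-/
theorem helmholtz_cconv {k : ℝ} {w : E3 → ℂ} (hw : IsDistribSolution k 0 w) {ρ : E3 → ℂ}
    (hρ : ContDiff ℝ (⊤ : ℕ∞) ρ) (hc : HasCompactSupport ρ) (x : E3) :
    Laplacian.laplacian (cconv w ρ) x + (k : ℂ) ^ 2 * cconv w ρ x = 0 := by
  have h2 : (2 : WithTop ℕ∞) ≤ ((⊤ : ℕ∞) : WithTop ℕ∞) :=
    WithTop.coe_le_coe.2 (le_top : (2 : ℕ∞) ≤ ⊤)
  have hs : ContDiff ℝ (⊤ : ℕ∞) fun z => ρ (x - z) := hρ.comp (contDiff_const.sub contDiff_id)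
  have hsc : HasCompactSupport fun z => ρ (x - z) := hc.comp_homeomorph (Homeomorph.subLeft x)
  have key := hw.2 _ hs hsc
  rw [laplacian_cconv hw.1 hρ hc]
  simp only [cconv, convolution_def, ContinuousLinearMap.mul_apply']
  rw [← integral_const_mul, ← integral_add]
  · simp only [laplacian_comp_const_sub hρ, Pi.zero_apply, zero_mul, integral_zero] at key
    rw [← key]
    congr 1
    ext t
    ring
  · exact (hasCompactSupport_laplacian hρ hc).convolutionExists_right (ContinuousLinearMap.mul ℝ ℂ) hw.1
      (continuous_laplacian (hρ.of_le h2)) x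
  · exact (hc.convolutionExists_right (ContinuousLinearMap.mul ℝ ℂ) hw.1
      hρ.continuous x).const_mul _

/-- Radial kernels act on solutions of the Helmholtz equation as multiplication by a constant. -/
theorem cconv_radial {k : ℝ} (hk : 0 < k) {v : E3 → ℂ} (hv : ContDiff ℝ 2 v)
    (hH : ∀ x, Laplacian.laplacian v x + (k : ℂ) ^ 2 * v x = 0) {g : ℝ → ℝ}
    (hψ : Continuous fun x : E3 => ((g ‖x‖ : ℝ) : ℂ))
    (hψc : HasCompactSupport fun x : E3 => ((g ‖x‖ : ℝ) : ℂ)) (x : E3) :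
    cconv v (fun x => ((g ‖x‖ : ℝ) : ℂ)) x =
      ((sigma.real Set.univ / k * ∫ r in Set.Ioi (0 : ℝ), r * g r * Real.sin (k * r) : ℝ) : ℂ) *
        v x := by
  have hvc := hv.continuous
  simp only [cconv, convolution_def, ContinuousLinearMap.mul_apply']
  have e0 : ∫ t, v t * ((g ‖x - t‖ : ℝ) : ℂ) = ∫ z, ((g ‖z‖ : ℝ) : ℂ) * v (x + z) := by
    rw [← integral_add_left_eq_self _ x]
    congr 1
    ext z
    rw [sub_add_cancel_left, norm_neg, mul_comm]
  have hi : Integrable fun z => ((g ‖z‖ : ℝ) : ℂ) * v (x + z) :=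
    (by fun_prop : Continuous _).integrable_of_hasCompactSupport hψc.mul_right
  rw [e0, integral_polar _ hi, Complex.ofReal_mul, mul_right_comm, ← integral_complex_ofReal,
    ← integral_const_mul]
  refine setIntegral_congr_fun measurableSet_Ioi fun r hr => ?_
  have hr' : (0 : ℝ) < r := hr
  have hm := sphereMean_of_helmholtz hv hH x hr'.le
  simp only [norm_smul_sphere hr', integral_const_mul]
  change r ^ 2 • ((g r : ℂ) * sphereMean v x r) = _
  have hk' : (k : ℂ) ≠ 0 := by exact_mod_cast hk.ne'
  rw [Complex.real_smul]
  push_cast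
  rw [mul_comm (k : ℂ) r] at hm ⊢
  field_simp
  linear_combination (r : ℂ) * g r * hm

/-- The integral is the multiplier of `cconv_radial` up to a positive factor; it must be nonzero to
be divided out. -/
theorem exists_radial_kernel {k : ℝ} (hk : 0 < k) : ∃ g : ℝ → ℝ,
    ContDiff ℝ (⊤ : ℕ∞) (fun x : E3 => ((g ‖x‖ : ℝ) : ℂ)) ∧
    HasCompactSupport (fun x : E3 => ((g ‖x‖ : ℝ) : ℂ)) ∧
    0 < ∫ r in Set.Ioi (0 : ℝ), r * g r * Real.sin (k * r) := by
  have hπ := Real.pi_pos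
  -- The support is [π/(4k), 3π/(4k)], inside (0, π/k), where sin(kr) is positive.
  let b : ContDiffBump (Real.pi / (2 * k)) :=
    { rIn := Real.pi / (8 * k), rOut := Real.pi / (4 * k), rIn_pos := by positivity
      rIn_lt_rOut := by gcongr; norm_num }
  have hsub : ∀ r ∈ tsupport b, 0 < r ∧ k * r < Real.pi := by
    intro r hr
    rw [b.tsupport_eq, Metric.mem_closedBall, Real.dist_eq, abs_le] at hr
    have h1 : Real.pi / (2 * k) - Real.pi / (4 * k) = Real.pi / (4 * k) := by field_simp; norm_num
    have h2 : Real.pi / (2 * k) + Real.pi / (4 * k) = (3 / 4 * Real.pi) / k := by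
      field_simp; norm_num
    have h3 : 0 < Real.pi / (4 * k) := by positivity
    have h4 : r ≤ (3 / 4 * Real.pi) / k := by
      have := hr.2; change _ ≤ Real.pi / (4 * k) at this; linarith
    rw [le_div_iff₀ hk] at h4
    refine ⟨?_, by linarith⟩
    have := hr.1; change -(Real.pi / (4 * k)) ≤ _ at this; linarith
  have hs : tsupport b ⊆ Set.Ioi 0 := fun r hr => (hsub r hr).1
  have hbc : HasCompactSupport b := b.hasCompactSupport
  refine ⟨b, Complex.ofRealCLM.contDiff.comp (contDiff_comp_norm b.contDiff hs), ?_, ?_⟩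
  · obtain ⟨R, hR⟩ := hbc.isCompact.isBounded.subset_closedBall 0
    refine HasCompactSupport.intro (isCompact_closedBall (0 : E3) R) fun x hx => ?_
    have : ‖x‖ ∉ tsupport b := fun h => hx (by simpa using hR h)
    simp [image_eq_zero_of_notMem_tsupport this]
  · rw [setIntegral_eq_integral_of_forall_compl_eq_zero fun r hr => by
      rw [image_eq_zero_of_notMem_tsupport fun h => hr (hs h)]; simp]
    have hbcont := b.continuous
    refine Continuous.integral_pos_of_hasCompactSupport_nonneg_nonzero (x := Real.pi / (2 * k))
      (by fun_prop) (hbc.mul_left.mul_right) (fun r => ?_) ?_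
    · by_cases hr : r ∈ tsupport b
      · obtain ⟨h1, h2⟩ := hsub r hr
        have := Real.sin_nonneg_of_nonneg_of_le_pi (by positivity : 0 ≤ k * r) h2.le
        have := b.nonneg (x := r)
        simp only [Pi.zero_apply]
        positivity
      · simp [image_eq_zero_of_notMem_tsupport hr]
    · have h1 : b (Real.pi / (2 * k)) = 1 :=
        b.one_of_mem_closedBall (Metric.mem_closedBall_self b.rIn_pos.le)
      have h2 : k * (Real.pi / (2 * k)) = Real.pi / 2 := by field_simp
      simp only [h1, h2, Real.sin_pi_div_two]
      positivity

theorem exists_mollifier : ∃ ρ : ℕ → E3 → ℂ, (∀ n, ContDiff ℝ (⊤ : ℕ∞) (ρ n)) ∧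
    (∀ n, HasCompactSupport (ρ n)) ∧ ∀ w : E3 → ℂ, LocallyIntegrable w →
      ∀ᵐ x, Tendsto (fun n => cconv w (ρ n) x) atTop (𝓝 (w x)) := by
  -- The fixed ratio 2 of the radii keeps the bumps comparable to averages over shrinking balls, as
  -- Lebesgue differentiation needs.
  let φ : ℕ → ContDiffBump (0 : E3) := fun n =>
    { rIn := 1 / ((n : ℝ) + 1) / 2, rOut := 1 / ((n : ℝ) + 1), rIn_pos := by positivity
      rIn_lt_rOut := half_lt_self (by positivity) }
  refine ⟨fun n x => (((φ n).normed volume x : ℝ) : ℂ),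
    fun n => Complex.ofRealCLM.contDiff.comp (φ n).contDiff_normed,
    fun n => (φ n).hasCompactSupport_normed.comp_left (g := fun t : ℝ => (t : ℂ)) (by simp),
    fun w hw => ?_⟩
  filter_upwards [ContDiffBump.ae_convolution_tendsto_right_of_locallyIntegrable (φ := φ)
    (l := atTop) (K := 2) tendsto_one_div_add_atTop_nhds_zero_nat
    (.of_forall fun n => by change 1 / ((n : ℝ) + 1) ≤ 2 * (1 / ((n : ℝ) + 1) / 2); linarith)
    hw] with x hx
  refine hx.congr fun n => ?_
  simp only [cconv, convolution_def, ContinuousLinearMap.mul_apply', ContinuousLinearMap.lsmul_apply,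
    Complex.real_smul]
  rw [← integral_sub_left_eq_self _ volume x]
  congr 1
  ext t
  rw [sub_sub_cancel, mul_comm]

/-- Weyl's lemma for the Helmholtz equation. -/
theorem exists_smooth_of_isDistribSolution {k : ℝ} (hk : 0 < k) {w : E3 → ℂ}
    (hw : IsDistribSolution k 0 w) : ∃ v : E3 → ℂ, ContDiff ℝ 2 v ∧
      (∀ x, Laplacian.laplacian v x + (k : ℂ) ^ 2 * v x = 0) ∧ w =ᵐ[volume] v := by
  have h2 : (2 : WithTop ℕ∞) ≤ ((⊤ : ℕ∞) : WithTop ℕ∞) :=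
    WithTop.coe_le_coe.2 (le_top : (2 : ℕ∞) ≤ ⊤)
  obtain ⟨g, hψ, hψc, hpos⟩ := exists_radial_kernel hk
  obtain ⟨ρ, hρ, hρc, hlim⟩ := exists_mollifier
  set ψ : E3 → ℂ := fun x => ((g ‖x‖ : ℝ) : ℂ) with hψdef
  set c : ℂ := ((sigma.real Set.univ / k *
    ∫ r in Set.Ioi (0 : ℝ), r * g r * Real.sin (k * r) : ℝ) : ℂ) with hc
  have hc0 : c ≠ 0 := by
    have := sigma_univ_pos
    rw [hc]
    exact_mod_cast (by positivity : (0 : ℝ) < _).ne'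
  have hsψ : ContDiff ℝ (⊤ : ℕ∞) fun x => c⁻¹ * ψ x := contDiff_const.mul hψ
  have hcψ : HasCompactSupport fun x => c⁻¹ * ψ x := hψc.mul_left
  refine ⟨cconv w fun x => c⁻¹ * ψ x, (contDiff_cconv hw.1 hsψ hcψ).of_le h2,
    fun x => helmholtz_cconv hw hsψ hcψ x, ?_⟩
  have hcc : Continuous (cconv w ψ) := (contDiff_cconv hw.1 hψ hψc).continuous
  filter_upwards [hlim w hw.1, hlim _ hcc.locallyIntegrable] with x hx1 hx2
  -- Commuting the kernels gives (w ∗ ψ) ∗ ρₙ = (w ∗ ρₙ) ∗ ψ, and ψ acts on the smooth solution w ∗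
  -- ρₙ as the constant c. In the limit w ∗ ψ = c w almost everywhere.
  have e : ∀ n, cconv (cconv w ψ) (ρ n) x = c * cconv w (ρ n) x := fun n => by
    rw [cconv_assoc hw.1 hψ.continuous (hρ n).continuous hψc (hρc n), cconv_comm ψ,
      ← cconv_assoc hw.1 (hρ n).continuous hψ.continuous (hρc n) hψc]
    exact cconv_radial hk ((contDiff_cconv hw.1 (hρ n) (hρc n)).of_le h2)
      (helmholtz_cconv hw (hρ n) (hρc n)) hψ.continuous hψc x
  simp only [e] at hx2
  have hlast := tendsto_nhds_unique (hx1.const_mul c) hx2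
  have e2 : cconv w (fun x => c⁻¹ * ψ x) x = c⁻¹ * cconv w ψ x := by
    simp only [cconv, convolution_def, ContinuousLinearMap.mul_apply']
    rw [← integral_const_mul]
    congr 1
    ext t
    ring
  rw [e2, ← hlast, inv_mul_cancel_left₀ hc0]

/-! ### Linearity of the conditions and uniqueness. -/

theorem integrable_mul_testFunction {k : ℝ} {u φ : E3 → ℂ} (hu : LocallyIntegrable u)
    (hφ : ContDiff ℝ (⊤ : ℕ∞) φ) (hc : HasCompactSupport φ) :
    Integrable fun x => u x * (Laplacian.laplacian φ x + (k : ℂ) ^ 2 * φ x) := by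
  have h2 : (2 : WithTop ℕ∞) ≤ ((⊤ : ℕ∞) : WithTop ℕ∞) :=
    WithTop.coe_le_coe.2 (le_top : (2 : ℕ∞) ≤ ⊤)
  have h1 := continuous_laplacian (hφ.of_le h2)
  have h3 := hφ.continuous
  have h4 : HasCompactSupport fun x => Laplacian.laplacian φ x + (k : ℂ) ^ 2 * φ x :=
    (hasCompactSupport_laplacian hφ hc).add hc.mul_left
  simpa only [smul_eq_mul] using
    hu.integrable_smul_right_of_hasCompactSupport (by fun_prop) h4

theorem IsDistribSolution.sub {k : ℝ} {f u₁ u₂ : E3 → ℂ} (h₁ : IsDistribSolution k f u₁)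
    (h₂ : IsDistribSolution k f u₂) : IsDistribSolution k 0 (u₁ - u₂) := by
  refine ⟨h₁.1.sub h₂.1, fun φ hφ hc => ?_⟩
  simp only [Pi.sub_apply, sub_mul, Pi.zero_apply, zero_mul, integral_zero]
  rw [integral_sub (integrable_mul_testFunction h₁.1 hφ hc)
    (integrable_mul_testFunction h₂.1 hφ hc), h₁.2 φ hφ hc, h₂.2 φ hφ hc, sub_self]

theorem SommerfeldCondition.sub {k : ℝ} {u₁ u₂ : E3 → ℂ} (h₁ : SommerfeldCondition k u₁)
    (h₂ : SommerfeldCondition k u₂) : SommerfeldCondition k (u₁ - u₂) := by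
  refine ⟨?_, ?_⟩
  · filter_upwards [h₁.1, h₂.1] with x hx₁ hx₂ using hx₁.sub hx₂
  · have h := h₁.2.sub h₂.2
    rw [sub_zero] at h
    refine h.congr' ?_
    filter_upwards [h₁.1, h₂.1] with x hx₁ hx₂
    rw [fderiv_sub hx₁ hx₂, sub_apply, Pi.sub_apply]
    ring

theorem IsRadiatingSolution.neg {k : ℝ} {f u : E3 → ℂ} (h : IsRadiatingSolution k f u) :
    IsRadiatingSolution k (-f) (-u) := by
  refine ⟨⟨h.1.1.neg, fun φ hφ hc => ?_⟩, ?_, ?_⟩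
  · simp only [Pi.neg_apply, neg_mul, integral_neg, h.1.2 φ hφ hc]
  · filter_upwards [h.2.1] with x hx using hx.neg
  · have h' := h.2.2.neg
    rw [neg_zero] at h'
    refine h'.congr fun x => ?_
    rw [fderiv_neg, neg_apply, Pi.neg_apply]
    ring

/-- Radiating solutions are unique up to null sets. -/
theorem IsRadiatingSolution.ae_eq {k : ℝ} (hk : 0 < k) {f u₁ u₂ : E3 → ℂ}
    (h₁ : IsRadiatingSolution k f u₁) (h₂ : IsRadiatingSolution k f u₂) : u₁ =ᵐ[volume] u₂ := by
  obtain ⟨v, hv, hH, hae⟩ := exists_smooth_of_isDistribSolution hk (h₁.1.sub h₂.1)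
  have hS := h₁.2.sub h₂.2
  set w := u₁ - u₂ with hw
  have hev := hS.1
  rw [← comap_norm_atTop, eventually_comap] at hev
  obtain ⟨R, hR⟩ := eventually_atTop.1 hev
  -- Here w is differentiable, hence continuous, so w = v holds at every point of this open set; the
  -- derivatives agree too, and v inherits the radiation condition.
  set U : Set E3 := {x | R < ‖x‖} with hU
  have hUo : IsOpen U := isOpen_lt continuous_const continuous_norm
  have heq : Set.EqOn w v U := Measure.eqOn_open_of_ae_eq (ae_restrict_of_ae hae) hUo
    (fun x hx => (hR ‖x‖ (le_of_lt hx) x rfl).continuousAt.continuousWithinAt)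
    hv.continuous.continuousOn
  have hUev : ∀ᶠ x in Bornology.cobounded E3, x ∈ U :=
    tendsto_norm_cobounded_atTop.eventually (eventually_gt_atTop R)
  have hSv : Tendsto (fun x : E3 => (‖x‖ : ℂ) *
      (fderiv ℝ v x (‖x‖⁻¹ • x) - Complex.I * (k : ℂ) * v x)) (Bornology.cobounded E3) (𝓝 0) := by
    refine hS.2.congr' ?_
    filter_upwards [hUev] with x hx
    rw [heq hx, (heq.eventuallyEq_of_mem (hUo.mem_nhds hx)).fderiv_eq]
  filter_upwards [hae] with x hx
  rw [eq_zero_of_helmholtz_of_sommerfeld hk hv hH hSv x] at hx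
  exact sub_eq_zero.1 hx

/-! ### Radial profiles of the explicit solution and continuity. -/

/-- `d` times the radial profile of `ballSolution` inside the ball. -/
noncomputable def innerProfile (k r s : ℝ) : ℂ :=
  (1 - Complex.I * k * r) * Complex.exp (Complex.I * k * r) / (k : ℂ) ^ 3 * Complex.sin (k * s) -
    s / (k : ℂ) ^ 2

/-- The amplitude of the outgoing wave. -/
noncomputable def outerAmplitude (k r : ℝ) : ℂ :=
  (Complex.sin (k * r) - k * r * Complex.cos (k * r)) / (k : ℂ) ^ 3

/-- `d` times the radial profile of `ballSolution` outside the ball. -/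
noncomputable def outerProfile (k r s : ℝ) : ℂ :=
  outerAmplitude k r * Complex.exp (Complex.I * k * s)

theorem exp_I_mul_mul (k s : ℝ) : Complex.exp (Complex.I * k * s) =
    Complex.cos (k * s) + Complex.sin (k * s) * Complex.I := by
  rw [← Complex.exp_mul_I]; congr 1; ring

theorem exp_I_mul_sub (k s t : ℝ) : Complex.exp (Complex.I * k * (s - t)) =
    (Complex.cos (k * s) + Complex.sin (k * s) * Complex.I) *
      (Complex.cos (k * t) - Complex.sin (k * t) * Complex.I) := by
  have : Complex.I * k * (s - t) = (k * s : ℂ) * Complex.I + (-(k * t) : ℂ) * Complex.I := by ring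
  rw [this, Complex.exp_add, Complex.exp_mul_I, Complex.exp_mul_I, Complex.cos_neg, Complex.sin_neg]
  ring

theorem exp_I_mul_add (k s t : ℝ) : Complex.exp (Complex.I * k * (s + t)) =
    (Complex.cos (k * s) + Complex.sin (k * s) * Complex.I) *
      (Complex.cos (k * t) + Complex.sin (k * t) * Complex.I) := by
  have : Complex.I * k * (s + t) = (k * s : ℂ) * Complex.I + (k * t : ℂ) * Complex.I := by ring
  rw [this, Complex.exp_add, Complex.exp_mul_I, Complex.exp_mul_I]

theorem innerProfile_boundary {k : ℝ} (hk : 0 < k) (r : ℝ) :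
    innerProfile k r r = outerProfile k r r := by
  have hk' : (k : ℂ) ≠ 0 := by exact_mod_cast hk.ne'
  have hsc := Complex.sin_sq_add_cos_sq ((k : ℂ) * r)
  simp only [innerProfile, outerProfile, outerAmplitude, exp_I_mul_mul]
  field_simp
  set S := Complex.sin (k * r)
  set c := Complex.cos (k * r)
  linear_combination (k * r : ℂ) * hsc - (k * r * S ^ 2 : ℂ) * (Complex.I_sq)

theorem ballSolution_outside {k : ℝ} (hk : 0 < k) {r : ℝ} (hr : 0 ≤ r) {x₀ x : E3}
    (hx : r < ‖x - x₀‖) :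
    ballSolution k r x₀ x = outerProfile k r ‖x - x₀‖ / ‖x - x₀‖ := by
  have hd : 0 < ‖x - x₀‖ := hr.trans_lt hx
  have hne : x ≠ x₀ := fun h => by simp [h] at hd
  have hk' : (k : ℂ) ≠ 0 := by exact_mod_cast hk.ne'
  have hd' : (‖x - x₀‖ : ℂ) ≠ 0 := by exact_mod_cast hd.ne'
  have hmem : x ∉ Metric.closedBall x₀ r := by
    rw [mem_closedBall_iff_norm]; exact not_le.2 hx
  simp only [ballSolution, if_neg hne, if_neg hmem, outerProfile, outerAmplitude, exp_I_mul_sub,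
    exp_I_mul_add, exp_I_mul_mul]
  field_simp
  linear_combination (-2 * Complex.sin (k * r) * (Complex.cos (k * ‖x - x₀‖) +
    Complex.I * Complex.sin (k * ‖x - x₀‖))) * Complex.I_sq

theorem ballSolution_inside {k : ℝ} (hk : 0 < k) {r : ℝ} {x₀ x : E3}
    (hx : ‖x - x₀‖ ≤ r) (hne : x ≠ x₀) :
    ballSolution k r x₀ x = innerProfile k r ‖x - x₀‖ / ‖x - x₀‖ := by
  have hd : 0 < ‖x - x₀‖ := norm_pos_iff.2 (sub_ne_zero.2 hne)
  have hk' : (k : ℂ) ≠ 0 := by exact_mod_cast hk.ne'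
  have hd' : (‖x - x₀‖ : ℂ) ≠ 0 := by exact_mod_cast hd.ne'
  have hmem : x ∈ Metric.closedBall x₀ r := by
    rw [mem_closedBall_iff_norm]; exact hx
  simp only [ballSolution, if_neg hne, if_pos hmem, innerProfile, exp_I_mul_sub,
    exp_I_mul_add, exp_I_mul_mul]
  field_simp
  linear_combination (-2 * Complex.sin (k * ‖x - x₀‖) * (Complex.cos (k * r) +
    Complex.I * Complex.sin (k * r))) * Complex.I_sq

/-- Writing sin(kd)/d through `Real.sinc` absorbs the centre into one continuous formula. -/
theorem ballSolution_of_le {k : ℝ} (hk : 0 < k) {r : ℝ} {x₀ x : E3}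
    (hx : ‖x - x₀‖ ≤ r) :
    ballSolution k r x₀ x = (1 - Complex.I * k * r) * Complex.exp (Complex.I * k * r) /
      (k : ℂ) ^ 2 * Real.sinc (k * ‖x - x₀‖) - 1 / (k : ℂ) ^ 2 := by
  have hk' : (k : ℂ) ≠ 0 := by exact_mod_cast hk.ne'
  rcases eq_or_ne x x₀ with rfl | hne
  · simp only [ballSolution, if_true, sub_self, norm_zero, mul_zero, Real.sinc_zero,
      Complex.ofReal_one]
    ring
  · have hd : 0 < ‖x - x₀‖ := norm_pos_iff.2 (sub_ne_zero.2 hne)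
    have hd' : (‖x - x₀‖ : ℂ) ≠ 0 := by exact_mod_cast hd.ne'
    rw [ballSolution_inside hk hx hne, innerProfile,
      Real.sinc_of_ne_zero (mul_pos hk hd).ne']
    push_cast
    field_simp

theorem ballSolution_of_ge {k : ℝ} (hk : 0 < k) {r : ℝ} (hr : 0 ≤ r) {x₀ x : E3}
    (hx : r ≤ ‖x - x₀‖) (hne : x ≠ x₀) :
    ballSolution k r x₀ x = outerProfile k r ‖x - x₀‖ / ‖x - x₀‖ := by
  rcases hx.eq_or_lt with h | h
  · rw [ballSolution_inside hk h.ge hne, ← h, innerProfile_boundary hk]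
  · exact ballSolution_outside hk hr h

theorem outerAmplitude_zero (k : ℝ) : outerAmplitude k 0 = 0 := by simp [outerAmplitude]

theorem continuous_ballSolution {k : ℝ} (hk : 0 < k) {r : ℝ} (hr : 0 ≤ r) (x₀ : E3) :
    Continuous (ballSolution k r x₀) := by
  have hin : ContinuousOn (ballSolution k r x₀) {x | ‖x - x₀‖ ≤ r} := by
    refine ContinuousOn.congr (Continuous.continuousOn ?_) fun x hx => ballSolution_of_le hk hx
    have := Real.continuous_sinc
    fun_prop
  have hout : ContinuousOn (ballSolution k r x₀) {x | r ≤ ‖x - x₀‖} := by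
    -- For r = 0 the outer region contains x₀, where division by d is unavailable; there the
    -- function is identically zero.
    rcases hr.eq_or_lt with h | h
    · subst h
      refine (continuousOn_const (c := (0 : ℂ))).congr fun x _ => ?_
      rcases eq_or_ne x x₀ with rfl | hne
      · rw [ballSolution_of_le hk (by simp)]; simp
      · rw [ballSolution_of_ge hk le_rfl (norm_nonneg _) hne, outerProfile, outerAmplitude_zero]
        simp
    · have hd : ∀ x ∈ {x | r ≤ ‖x - x₀‖}, (‖x - x₀‖ : ℂ) ≠ 0 := fun x hx => by
        exact_mod_cast (h.trans_le hx).ne'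
      refine ContinuousOn.congr (f := fun x => outerProfile k r ‖x - x₀‖ / ‖x - x₀‖) ?_
        fun x hx => ballSolution_of_ge hk hr hx fun hne => hd x hx (by simp [hne])
      refine ContinuousOn.div (Continuous.continuousOn ?_) (by fun_prop) hd
      unfold outerProfile
      fun_prop
  have hU : {x : E3 | ‖x - x₀‖ ≤ r} ∪ {x | r ≤ ‖x - x₀‖} = Set.univ :=
    Set.eq_univ_of_forall fun x => le_total ‖x - x₀‖ r
  rw [← continuousOn_univ, ← hU]
  exact hin.union_of_isClosed hout (isClosed_le (by fun_prop) (by fun_prop))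
    (isClosed_le (by fun_prop) (by fun_prop))

/-! ### Differential equations of the profiles. -/

section Profiles

theorem hasDerivAt_sin_mul (k s : ℝ) :
    HasDerivAt (fun s : ℝ => Complex.sin (k * s)) (Complex.cos (k * s) * k) s := by
  have : HasDerivAt (fun s : ℝ => (k : ℂ) * (s : ℂ)) k s := by
    simpa using ((hasDerivAt_id s).ofReal_comp).const_mul (k : ℂ)
  exact (Complex.hasDerivAt_sin _).comp s this

theorem hasDerivAt_cos_mul (k s : ℝ) :
    HasDerivAt (fun s : ℝ => Complex.cos (k * s)) (-Complex.sin (k * s) * k) s := by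
  have : HasDerivAt (fun s : ℝ => (k : ℂ) * (s : ℂ)) k s := by
    simpa using ((hasDerivAt_id s).ofReal_comp).const_mul (k : ℂ)
  exact (Complex.hasDerivAt_cos _).comp s this

theorem hasDerivAt_exp_I_mul (k s : ℝ) :
    HasDerivAt (fun s : ℝ => Complex.exp (Complex.I * k * s))
      (Complex.exp (Complex.I * k * s) * (Complex.I * k)) s := by
  have : HasDerivAt (fun s : ℝ => (Complex.I * k : ℂ) * (s : ℂ)) (Complex.I * k) s := by
    simpa using ((hasDerivAt_id s).ofReal_comp).const_mul (Complex.I * k : ℂ)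
  exact (Complex.hasDerivAt_exp _).comp s this

/-- The derivative of `innerProfile`. -/
noncomputable def innerProfileDeriv (k r s : ℝ) : ℂ :=
  (1 - Complex.I * k * r) * Complex.exp (Complex.I * k * r) / (k : ℂ) ^ 3 *
    (Complex.cos (k * s) * k) - 1 / (k : ℂ) ^ 2

/-- The derivative of `outerProfile`. -/
noncomputable def outerProfileDeriv (k r s : ℝ) : ℂ :=
  outerAmplitude k r * (Complex.exp (Complex.I * k * s) * (Complex.I * k))

theorem hasDerivAt_innerProfile (k r s : ℝ) :
    HasDerivAt (innerProfile k r) (innerProfileDeriv k r s) s :=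
  ((hasDerivAt_sin_mul k s).const_mul _).sub (((hasDerivAt_id s).ofReal_comp).div_const _)

theorem hasDerivAt_outerProfile (k r s : ℝ) :
    HasDerivAt (outerProfile k r) (outerProfileDeriv k r s) s :=
  (hasDerivAt_exp_I_mul k s).const_mul _

theorem hasDerivAt_innerProfileDeriv {k : ℝ} (hk : 0 < k) (r s : ℝ) :
    HasDerivAt (innerProfileDeriv k r) (-(k : ℂ) ^ 2 * innerProfile k r s - s) s := by
  have hk' : (k : ℂ) ≠ 0 := by exact_mod_cast hk.ne'
  refine ((((hasDerivAt_cos_mul k s).mul_const _).const_mul _).sub_const _).congr_deriv ?_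
  simp only [innerProfile]
  field_simp
  ring

theorem hasDerivAt_outerProfileDeriv (k r s : ℝ) :
    HasDerivAt (outerProfileDeriv k r) (-(k : ℂ) ^ 2 * outerProfile k r s) s := by
  refine (((hasDerivAt_exp_I_mul k s).mul_const _).const_mul _).congr_deriv ?_
  simp only [outerProfile]
  linear_combination (outerAmplitude k r * Complex.exp (Complex.I * k * s) * k ^ 2) * Complex.I_sq

/-- With `innerProfile_boundary` this is the C¹ matching that excludes a surface source on the
sphere. -/
theorem innerProfileDeriv_boundary {k : ℝ} (hk : 0 < k) (r : ℝ) :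
    innerProfileDeriv k r r = outerProfileDeriv k r r := by
  have hk' : (k : ℂ) ≠ 0 := by exact_mod_cast hk.ne'
  have hsc := Complex.sin_sq_add_cos_sq ((k : ℂ) * r)
  simp only [innerProfileDeriv, outerProfileDeriv, outerAmplitude, exp_I_mul_mul]
  field_simp
  set S := Complex.sin (k * r)
  set c := Complex.cos (k * r)
  linear_combination hsc - S ^ 2 * Complex.I_sq

/-- Lagrange's identity for `p'' + k² p = -g`, integrated against a spherical mean. -/
theorem integral_profile_mul_sphereMean {k : ℝ} {φ : E3 → ℂ} (hφ : ContDiff ℝ 2 φ) (y : E3)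
    {p p' g : ℝ → ℂ} (hg : Continuous g) (hp : ∀ s, HasDerivAt p (p' s) s)
    (hp' : ∀ s, HasDerivAt p' (-(k : ℂ) ^ 2 * p s - g s) s) {a b : ℝ} (ha : 0 ≤ a) (hab : a ≤ b) :
    ∫ s in a..b, (p s * (s * sphereMean (fun x => Laplacian.laplacian φ x + (k : ℂ) ^ 2 * φ x) y s) +
      g s * (s * sphereMean φ y s)) =
    (p b * sphereMeanDeriv φ y b - p' b * (b * sphereMean φ y b)) -
      (p a * sphereMeanDeriv φ y a - p' a * (a * sphereMean φ y a)) := by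
  have hφ1 : ContDiff ℝ 1 φ := hφ.of_le (by norm_num)
  have cp : Continuous p := continuous_iff_continuousAt.2 fun s => (hp s).continuousAt
  have cp' : Continuous p' := continuous_iff_continuousAt.2 fun s => (hp' s).continuousAt
  have cq := continuous_sphereMeanDeriv hφ1 y
  have cM := continuous_sphereMean hφ.continuous y
  have cL := continuous_laplacian hφ
  have cφ := hφ.continuous
  have cT := continuous_sphereMean
    (by fun_prop : Continuous fun x => Laplacian.laplacian φ x + (k : ℂ) ^ 2 * φ x) y
  refine intervalIntegral.integral_eq_sub_of_hasDerivAt_of_le hab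
    (f := fun s : ℝ => p s * sphereMeanDeriv φ y s - p' s * (s * sphereMean φ y s))
    (by fun_prop) (fun s hs => ?_) ((by fun_prop : Continuous _).intervalIntegrable _ _)
  have hs0 : 0 < s := ha.trans_lt hs.1
  have hT : sphereMean (fun x => Laplacian.laplacian φ x + (k : ℂ) ^ 2 * φ x) y s =
      sphereMean (Laplacian.laplacian φ) y s + (k : ℂ) ^ 2 * sphereMean φ y s := by
    simp only [sphereMean]
    rw [integral_add (integrable_sphere (by fun_prop)) (integrable_sphere (by fun_prop)),
      integral_const_mul]
  refine (((hp s).mul (hasDerivAt_sphereMeanDeriv hφ y hs0)).sub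
    ((hp' s).mul (hasDerivAt_mul_sphereMean hφ1 y s))).congr_deriv ?_
  rw [hT]
  ring

end Profiles

/-! ### The distributional equation. -/

theorem isDistribSolution_ballSolution {k : ℝ} (hk : 0 < k) {r : ℝ} (hr : 0 ≤ r) (x₀ : E3) :
    IsDistribSolution k (-chi x₀ r) (ballSolution k r x₀) := by
  have cu := continuous_ballSolution hk hr x₀
  refine ⟨cu.locallyIntegrable, fun φ hφ hc => ?_⟩
  have h2 : (2 : WithTop ℕ∞) ≤ ((⊤ : ℕ∞) : WithTop ℕ∞) :=
    WithTop.coe_le_coe.2 (le_top : (2 : ℕ∞) ≤ ⊤)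
  have hφ2 : ContDiff ℝ 2 φ := hφ.of_le h2
  have cφ := hφ.continuous
  have cL := continuous_laplacian hφ2
  set T : E3 → ℂ := fun x => Laplacian.laplacian φ x + (k : ℂ) ^ 2 * φ x with hT
  have cT : Continuous T := by fun_prop
  have hTc : HasCompactSupport T := (hasCompactSupport_laplacian hφ hc).add hc.mul_left
  obtain ⟨R₀, hR₀⟩ := (hc.isCompact.isBounded.union hTc.isCompact.isBounded).subset_closedBall x₀
  -- The extra 1 puts the sphere of radius R strictly outside the support of φ, so the boundary
  -- terms at R vanish.
  set R := max R₀ r + 1 with hR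
  have hR₀R : R₀ < R := (le_max_left _ _).trans_lt (lt_add_one _)
  have hrR : r ≤ R := (le_max_right _ _).trans (lt_add_one _).le
  have hR0 : 0 < R := (hr.trans (le_max_right R₀ r)).trans_lt (lt_add_one _)
  have hsphere : ∀ θ : Metric.sphere (0 : E3) 1, x₀ + R • (θ : E3) ∉ tsupport φ := fun θ h => by
    have := hR₀ (Or.inl h)
    rw [mem_closedBall_iff_norm, add_sub_cancel_left, norm_smul_sphere hR0] at this
    exact absurd this (not_le.2 hR₀R)
  have hMR : sphereMean φ x₀ R = 0 := by
    simp only [sphereMean, image_eq_zero_of_notMem_tsupport (hsphere _), integral_zero]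
  have hqR : sphereMeanDeriv φ x₀ R = 0 := by
    have : ∀ θ : Metric.sphere (0 : E3) 1, fderiv ℝ φ (x₀ + R • (θ : E3)) = 0 := fun θ =>
      image_eq_zero_of_notMem_tsupport fun h => hsphere θ (tsupport_fderiv_subset ℝ h)
    simp [sphereMeanDeriv, hMR, this]
  have hlhs : ∫ x, ballSolution k r x₀ x * T x =
      ∫ x in Metric.closedBall x₀ R, ballSolution k r x₀ x * T x := by
    refine (setIntegral_eq_integral_of_forall_compl_eq_zero fun x hx => ?_).symm
    rw [image_eq_zero_of_notMem_tsupport fun h => hx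
      (Metric.closedBall_subset_closedBall hR₀R.le (hR₀ (Or.inr h))), mul_zero]
  have hrhs : ∫ x, (-chi x₀ r) x * φ x = -∫ x in Metric.closedBall x₀ r, φ x := by
    rw [← integral_indicator Metric.isClosed_closedBall.measurableSet, ← integral_neg]
    congr 1
    ext x
    by_cases hx : x ∈ Metric.closedBall x₀ r
    · simp only [chi, Pi.neg_apply, Set.indicator_of_mem hx]; ring
    · simp only [chi, Pi.neg_apply, Set.indicator_of_notMem hx]; ring
  rw [hlhs, hrhs, setIntegral_closedBall_polar
    (h := fun x => ballSolution k r x₀ x * T x) (cu.mul cT) x₀ hR0.le,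
    setIntegral_closedBall_polar cφ x₀ hr]
  have hne : ∀ {s : ℝ}, 0 < s → ∀ θ : Metric.sphere (0 : E3) 1, x₀ + s • (θ : E3) ≠ x₀ :=
    fun {s} hs θ h => by
      have h1 := norm_smul_sphere hs θ
      rw [add_eq_left.1 h, norm_zero] at h1
      exact hs.ne h1
  -- The quotient form is required only for s > 0; at s = 0 both sides vanish through their factors
  -- of s.
  have slice : ∀ {s : ℝ} {p : ℂ}, (0 < s → ∀ θ : Metric.sphere (0 : E3) 1,
      ballSolution k r x₀ (x₀ + s • (θ : E3)) = p / s) → 0 ≤ s →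
      s ^ 2 • ∫ θ, ballSolution k r x₀ (x₀ + s • (θ : E3)) * T (x₀ + s • (θ : E3)) ∂sigma =
        p * (s * sphereMean T x₀ s) := by
    intro s p h hs
    rcases hs.eq_or_lt with h0 | h0
    · subst h0; simp
    · have h0' : (s : ℂ) ≠ 0 := by exact_mod_cast h0.ne'
      simp only [h h0, integral_const_mul, Complex.real_smul, sphereMean]
      push_cast
      field_simp
  set N : ℝ → ℂ := fun s =>
    s ^ 2 • ∫ θ, ballSolution k r x₀ (x₀ + s • (θ : E3)) * T (x₀ + s • (θ : E3)) ∂sigma with hN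
  have cN : Continuous N := by
    have : Continuous fun s : ℝ =>
        ∫ θ, ballSolution k r x₀ (x₀ + s • (θ : E3)) * T (x₀ + s • (θ : E3)) ∂sigma :=
      continuous_sphere_integral (by simp only [Function.uncurry_def]; fun_prop)
    fun_prop
  have hin : ∀ s ∈ Set.uIcc 0 r, N s = innerProfile k r s * (s * sphereMean T x₀ s) := by
    intro s hs
    rw [Set.uIcc_of_le hr] at hs
    refine slice (fun h0 θ => ?_) hs.1
    have e : ‖x₀ + s • (θ : E3) - x₀‖ = s := by rw [add_sub_cancel_left, norm_smul_sphere h0]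
    rw [ballSolution_inside hk (by rw [e]; exact hs.2) (hne h0 θ), e]
  have hout : ∀ s ∈ Set.uIcc r R, N s =
      outerProfile k r s * (s * sphereMean T x₀ s) + 0 * (s * sphereMean φ x₀ s) := by
    intro s hs
    rw [Set.uIcc_of_le hrR] at hs
    rw [zero_mul, add_zero]
    refine slice (fun h0 θ => ?_) (hr.trans hs.1)
    have e : ‖x₀ + s • (θ : E3) - x₀‖ = s := by rw [add_sub_cancel_left, norm_smul_sphere h0]
    rw [ballSolution_of_ge hk hr (by rw [e]; exact hs.1) (hne h0 θ), e]
  have Iin := integral_profile_mul_sphereMean (k := k) hφ2 x₀ (g := fun s => (s : ℂ))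
    Complex.continuous_ofReal (hasDerivAt_innerProfile k r) (hasDerivAt_innerProfileDeriv hk r)
    le_rfl hr
  have Iout := integral_profile_mul_sphereMean (k := k) hφ2 x₀ (g := fun _ => 0)
    continuous_const (hasDerivAt_outerProfile k r)
    (fun s => (hasDerivAt_outerProfileDeriv k r s).congr_deriv (by ring)) hr hrR
  have cM := continuous_sphereMean cφ x₀
  have cTM := continuous_sphereMean cT x₀
  have cin : Continuous (innerProfile k r) :=
    continuous_iff_continuousAt.2 fun s => (hasDerivAt_innerProfile k r s).continuousAt
  rw [intervalIntegral.integral_add ((by fun_prop : Continuous _).intervalIntegrable _ _)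
    ((by fun_prop : Continuous _).intervalIntegrable _ _)] at Iin
  rw [← intervalIntegral.integral_add_adjacent_intervals (cN.intervalIntegrable 0 r)
    (cN.intervalIntegrable r R), intervalIntegral.integral_congr hin,
    intervalIntegral.integral_congr hout, Iout, hMR, hqR]
  have e3 : ∫ s in (0 : ℝ)..r, s ^ 2 • ∫ θ, φ (x₀ + s • (θ : E3)) ∂sigma =
      ∫ s in (0 : ℝ)..r, (s : ℂ) * (s * sphereMean φ x₀ s) := by
    congr 1
    ext s
    rw [Complex.real_smul, sphereMean]
    push_cast
    ring
  have hp0 : innerProfile k r 0 = 0 := by simp [innerProfile]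
  rw [e3]
  rw [hp0, innerProfile_boundary hk, innerProfileDeriv_boundary hk] at Iin
  simp only [Complex.ofReal_zero, zero_mul, mul_zero, sub_zero] at Iin
  -- The outer boundary term at r is minus the inner one, leaving the inner source integral.
  linear_combination Iin

/-! ### The radiation condition. -/

theorem sommerfeldCondition_ballSolution {k : ℝ} (hk : 0 < k) {r : ℝ} (hr : 0 ≤ r) (x₀ : E3) :
    SommerfeldCondition k (ballSolution k r x₀) := by
  set U : Set E3 := {x | r < ‖x - x₀‖} with hU
  have hUo : IsOpen U := isOpen_lt (by fun_prop) (by fun_prop)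
  have hderiv : ∀ x ∈ U, HasFDerivAt (ballSolution k r x₀)
      ((fderiv ℝ (fun y : E3 => ‖y‖) (x - x₀)).smulRight
        ((outerProfileDeriv k r ‖x - x₀‖ * ‖x - x₀‖ - outerProfile k r ‖x - x₀‖) /
          (‖x - x₀‖ : ℂ) ^ 2)) x := by
    intro x hx
    have hd : 0 < ‖x - x₀‖ := hr.trans_lt hx
    have hd' : (‖x - x₀‖ : ℂ) ≠ 0 := by exact_mod_cast hd.ne'
    have h1 : HasFDerivAt (fun y : E3 => ‖y - x₀‖) (fderiv ℝ (fun y : E3 => ‖y‖) (x - x₀)) x := by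
      have h2 := ((contDiffAt_norm (n := 1) ℝ (norm_pos_iff.1 hd)).differentiableAt
        (by norm_num)).hasFDerivAt
      exact (h2.comp x ((hasFDerivAt_id x).sub_const x₀)).congr_fderiv
        (ContinuousLinearMap.comp_id _)
    have h3 : HasDerivAt (fun s : ℝ => outerProfile k r s / s)
        ((outerProfileDeriv k r ‖x - x₀‖ * ‖x - x₀‖ - outerProfile k r ‖x - x₀‖) /
          (‖x - x₀‖ : ℂ) ^ 2) ‖x - x₀‖ :=
      ((hasDerivAt_outerProfile k r _).div ((hasDerivAt_id _).ofReal_comp) hd').congr_deriv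
        (by simp)
    refine HasFDerivAt.congr_of_eventuallyEq ?_
      (eventually_of_mem (hUo.mem_nhds hx) fun y hy => ballSolution_outside hk hr hy)
    have h4 := h3.hasFDerivAt.comp x h1
    exact h4.congr_fderiv (by ext e; simp)
  have hUev : ∀ᶠ x in Bornology.cobounded E3, x ∈ U := by
    filter_upwards [tendsto_norm_cobounded_atTop.eventually (eventually_gt_atTop (r + ‖x₀‖))]
      with x hx
    have := norm_sub_norm_le x x₀
    change r < ‖x - x₀‖
    linarith
  refine ⟨hUev.mono fun x hx => (hderiv x hx).differentiableAt, ?_⟩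
  set B := ‖outerAmplitude k r‖ * (2 * (2 * k * ‖x₀‖ + 1)) with hB
  have hlim : Tendsto (fun x : E3 => B / (‖x‖ - ‖x₀‖)) (Bornology.cobounded E3) (𝓝 0) :=
    (tendsto_atTop_add_const_right _ (-‖x₀‖) tendsto_norm_cobounded_atTop).const_div_atTop B
  refine squeeze_zero_norm' ?_ hlim
  filter_upwards [hUev, tendsto_norm_cobounded_atTop.eventually
    (eventually_gt_atTop (2 * ‖x₀‖))] with x hx hx2
  have hd : 0 < ‖x - x₀‖ := hr.trans_lt hx
  have hn : 0 < ‖x‖ := lt_of_le_of_lt (by positivity) hx2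
  have hx0 : 0 < ‖x‖ - ‖x₀‖ := by linarith [norm_nonneg x₀]
  have htri := norm_sub_norm_le x x₀
  have htri' : |‖x‖ - ‖x - x₀‖| ≤ ‖x₀‖ := by
    have := abs_norm_sub_norm_le x (x - x₀)
    rwa [sub_sub_cancel] at this
  set d := ‖x - x₀‖ with hddef
  -- The cosine of the angle between x - x₀ and x: the derivative of |x - x₀| in the direction
  -- x/|x|. It differs from 1 because the radiation condition is centred at 0.
  set t : ℝ := inner ℝ (x - x₀) x / (d * ‖x‖) with ht
  have hgrad : fderiv ℝ (fun y : E3 => ‖y‖) (x - x₀) (‖x‖⁻¹ • x) = t := by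
    have h := fderiv_comp_norm (g := id) contDiff_id (norm_pos_iff.1 hd) (‖x‖⁻¹ • x)
    simp only [id, deriv_id', one_mul] at h
    rw [h, inner_smul_right, ht, ← hddef]
    field_simp
  have ht1 : |t| ≤ 1 := by
    rw [ht, abs_div, abs_of_pos (by positivity : 0 < d * ‖x‖), div_le_one (by positivity)]
    exact abs_real_inner_le_norm _ _
  have ht2 : |t - 1| * d ≤ 2 * ‖x₀‖ := by
    have e : (t - 1) * d * ‖x‖ = (‖x‖ - d) * ‖x‖ - inner ℝ x₀ x := by
      rw [ht, inner_sub_left, real_inner_self_eq_norm_sq]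
      field_simp
      ring
    have h1 : |(t - 1) * d * ‖x‖| ≤ 2 * ‖x₀‖ * ‖x‖ := by
      rw [e]
      refine (abs_sub _ _).trans ?_
      rw [abs_mul, abs_of_pos hn]
      have := abs_real_inner_le_norm x₀ x
      nlinarith
    rw [abs_mul, abs_mul, abs_of_pos hn, abs_of_pos hd] at h1
    exact le_of_mul_le_mul_right h1 hn
  have hd' : (d : ℂ) ≠ 0 := by exact_mod_cast hd.ne'
  -- For an outgoing wave centred at 0 one would have t = 1 and the oscillating term would cancel;
  -- what remains is ik(t - 1) and t/d, both O(1/d).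
  have hval : (‖x‖ : ℂ) * (fderiv ℝ (ballSolution k r x₀) x (‖x‖⁻¹ • x) -
      Complex.I * k * ballSolution k r x₀ x) =
      outerAmplitude k r * Complex.exp (Complex.I * k * d) * ((‖x‖ / d : ℝ) : ℂ) *
        (Complex.I * ((k * (t - 1) : ℝ) : ℂ) - ((t / d : ℝ) : ℂ)) := by
    rw [(hderiv x hx).fderiv, ContinuousLinearMap.smulRight_apply, hgrad,
      ballSolution_outside hk hr hx, Complex.real_smul, ← hddef]
    simp only [outerProfile, outerProfileDeriv]
    push_cast
    field_simp
    ring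
  rw [hval, norm_mul, norm_mul, norm_mul]
  have hexp : ‖Complex.exp (Complex.I * k * d)‖ = 1 := by
    rw [show Complex.I * k * d = ((k * d : ℝ) : ℂ) * Complex.I by push_cast; ring,
      Complex.norm_exp_ofReal_mul_I]
  -- From |x| > 2|x₀| it follows that d ≥ |x| - |x₀| ≥ |x|/2.
  have hq : ‖(((‖x‖ / d : ℝ)) : ℂ)‖ ≤ 2 := by
    rw [Complex.norm_real, Real.norm_of_nonneg (by positivity), div_le_iff₀ hd]
    linarith
  have hbr : ‖Complex.I * ((k * (t - 1) : ℝ) : ℂ) - ((t / d : ℝ) : ℂ)‖ ≤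
      (2 * k * ‖x₀‖ + 1) / (‖x‖ - ‖x₀‖) := by
    have h1 : ‖Complex.I * ((k * (t - 1) : ℝ) : ℂ) - ((t / d : ℝ) : ℂ)‖ ≤
        (2 * k * ‖x₀‖ + 1) / d := by
      refine (norm_sub_le _ _).trans ?_
      rw [norm_mul, Complex.norm_I, one_mul, Complex.norm_real, Complex.norm_real,
        Real.norm_eq_abs, Real.norm_eq_abs, abs_mul, abs_div, abs_of_pos hk, abs_of_pos hd,
        le_div_iff₀ hd, add_mul, div_mul_cancel₀ _ hd.ne']
      nlinarith
    refine h1.trans ?_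
    gcongr
  rw [hexp, mul_one]
  calc _ ≤ ‖outerAmplitude k r‖ * 2 * ((2 * k * ‖x₀‖ + 1) / (‖x‖ - ‖x₀‖)) := by gcongr
    _ = _ := by rw [hB]; ring

theorem isRadiatingSolution_ballSolution {k : ℝ} (hk : 0 < k) {r : ℝ} (hr : 0 ≤ r) (x₀ : E3) :
    IsRadiatingSolution k (-chi x₀ r) (ballSolution k r x₀) :=
  ⟨isDistribSolution_ballSolution hk hr x₀, sommerfeldCondition_ballSolution hk hr x₀⟩

end Helmholtz

theorem proposition1 (k : ℝ) (hk : 0 < k) (r : ℝ) (hr : 0 ≤ r) (x₀ : Helmholtz.E3) :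
    Continuous (Helmholtz.ballSolution k r x₀) ∧
    (Helmholtz.IsRadiatingSolution k (-Helmholtz.chi x₀ r) (Helmholtz.ballSolution k r x₀) ∧
      ∀ u : Helmholtz.E3 → ℂ, Helmholtz.IsRadiatingSolution k (-Helmholtz.chi x₀ r) u →
        u =ᵐ[MeasureTheory.volume] Helmholtz.ballSolution k r x₀) ∧
    (Helmholtz.IsRadiatingSolution k (Helmholtz.chi x₀ r) (-Helmholtz.ballSolution k r x₀) ∧
      ∀ u : Helmholtz.E3 → ℂ, Helmholtz.IsRadiatingSolution k (Helmholtz.chi x₀ r) u →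
        u =ᵐ[MeasureTheory.volume] -Helmholtz.ballSolution k r x₀) := by
  have h := Helmholtz.isRadiatingSolution_ballSolution hk hr x₀
  have h' : Helmholtz.IsRadiatingSolution k (Helmholtz.chi x₀ r)
      (-Helmholtz.ballSolution k r x₀) := by
    simpa only [neg_neg] using h.neg
  exact ⟨Helmholtz.continuous_ballSolution hk hr x₀, ⟨h, fun u hu => hu.ae_eq hk h⟩,
    ⟨h', fun u hu => hu.ae_eq hk h'⟩⟩
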